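/- **Setting.** A sheet of graphene is the hexagonal $\mathbb Z^2$-periodic graph whose fundamental domain has a red vertex $v_1$, a green vertex $v_2$ and three edges of length $1$, joining $v_1$ to $v_2$, to $\xi_1v_2$ and to $\xi_2v_2$, where $\xi_1,\xi_2$ are the elementary shifts. An AA-stacked structure consists of $N\ge 1$ sheets, in which the red (respectively green) vertices of layers $j$ and $j+1$ in the same position are joined by a red (respectively green) connector edge of length $\ell_j^{\rm red}>0$ (respectively $\ell_j^{\rm green}>0$), $1\le j<N$. Every edge $e\cong[0,L_e]$ carries an operator $-d^2/dx^2+q_e(x)$ with a real integrable potential, invariantly under $\mathbb Z^2$, and every vertex $v$ a Robin condition $\sum_{e\ni v}f'(v)=\alpha_vf(v)$ with $\alpha_v$ real (outgoing derivatives). For an edge $e$ and real $\lambda$ let $\begin{pmatrix}c_e&s_e\\c_e'&s_e'\end{pmatrix}(\lambda)$ be the transfer matrix taking $(u(0),u'(0))$ to $(u(L_e),u'(L_e))$ for the solutions of $-u''+q_eu=\lambda u$, and let $\sigma_D$ be the set of $\lambda$ with $s_e(\lambda)=0$ for some edge $e$. The spectral matrix $\hat A(z,\lambda)$, $z\in(\mathbb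 C^*)^2$, $\lambda\notin\sigma_D$, is indexed by the $2N$ vertices of a fundamental domain; it is $-\mathrm{diag}(\alpha_v)$ plus, for every edge $e$ from $v$ to $gw$ ($g\in\mathbb Z^2$), the matrix $\frac1{s_e}\begin{pmatrix}-c_e&z^g\\z^{-g}&-s_e'\end{pmatrix}$ in the rows and columns $v,w$. The dispersion relation is the set of $(k,\lambda)\in\mathbb R^2\times(\mathbb R\setminus\sigma_D)$ with $\det\hat A(e^{ik_1},e^{ik_2},\lambda)=0$. Let $\tilde B_1(\lambda)$ and $\tilde B_2(\lambda)$ be the $N\times N$ diagonal blocks of $\hat A(z,\lambda)$ that belong to the red and to the green vertices (they do not depend on $z$). **Proposition.** Assume that (1) the potentials on all edges of all layers are identical and symmetric about the centre of the edge; (2) in each layer the two Robin parameters are equal; (3) for each $j$ the red and the green connector edge between layers $j$ and $j+1$ have the same length and the same potential (as functions of the distance to layer $j$). Let $s_0$ be the common function $s_e$ of the edges of the layers, and $$\Delta(\lambda)=s_0(\lambda)^2\,\tilde B_1(\lambda)\tilde B_2(\lambda),\qquad \tilde G(k)=\big|1+e^{ik_1}+e^{ik_2}\big|^2 .$$ Let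 $\lambda_0\in\mathbb R$, and let $\mu$ be a real function that is differentiable near $\lambda_0$ and twice differentiable at $\lambda_0$, such that $\mu(\lambda)$ is an eigenvalue of $\Delta(\lambda)$ for all $\lambda\ne\lambda_0$ near $\lambda_0$, and $\mu(\lambda_0)=0$, $\mu''(\lambda_0)\neq0$. Then the dispersion relation has a conical singularity at $(k_0,\lambda_0)$ for both $k_0=\pm(2\pi/3,-2\pi/3)$. Precisely: (a) All points $(k,\lambda)\ne(k_0,\lambda_0)$ near $(k_0,\lambda_0)$ with $\mu(\lambda)=\tilde G(k)$ belong to the dispersion relation; so does $(k_0,\lambda_0)$ if $\lambda_0\notin\sigma_D$. (b) Near $(k_0,\lambda_0)$ the set $\{(k,\lambda):\mu(\lambda)=\tilde G(k)\}$ is the union of the graphs of two functions $\lambda_-(k)$, $\lambda_+(k)$, continuous near $k_0$, with $\lambda_\pm(k_0)=\lambda_0$ and $\lambda_-(k)<\lambda_0<\lambda_+(k)$ for $k\neq k_0$ near $k_0$, and there is a constant $C>0$ such that, for both signs, $$\frac{(\lambda_\pm(k)-\lambda_0)^2}{\kappa_1^2-\kappa_1\kappa_2+\kappa_2^2}\to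 C\quad\text{as }k\to k_0,\qquad \kappa=k-k_0 .$$ Up to a constant factor, $\kappa_1^2-\kappa_1\kappa_2+\kappa_2^2$ is the squared Euclidean length of the vector $K$ in the plane of the lattice with $K\cdot\xi_i=\kappa_i$ ($\xi_1,\xi_2$ have equal length and enclose an angle of $60^\circ$). -/

import Mathlib

open Filter Topology MeasureTheory Set

namespace Graphene

noncomputable section

/-! ### The edge equation and its transfer matrix -/

/-- `u`, with derivative `v`, solves `-u'' + q u = lam u` on `[0, L]`, the potential `q` being
integrable: `u` is continuously differentiable and `u' = v` is the absolutely continuous function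
with `v' = (q - lam) u` almost everywhere. -/
structure IsEdgeSolution (q : ℝ → ℝ) (L lam : ℝ) (u v : ℝ → ℝ) : Prop where
  hasDeriv : ∀ x ∈ Icc 0 L, HasDerivWithinAt u (v x) (Icc 0 L) x
  deriv_eq : ∀ x ∈ Icc 0 L, v x = v 0 + ∫ t in (0 : ℝ)..x, (q t - lam) * u t

/-- `T` takes the data `(u(0), u'(0))` of every solution on `[0, L]` to `(u(L), u'(L))`. -/
def IsTransferMatrix (q : ℝ → ℝ) (L lam : ℝ) (T : Matrix (Fin 2) (Fin 2) ℝ) : Prop :=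
  ∀ u v : ℝ → ℝ, IsEdgeSolution q L lam u v → T.mulVec ![u 0, v 0] = ![u L, v L]

/-- The transfer matrix `T(lam) = (c, s; c', s')`, which is uniquely determined by
`IsTransferMatrix` when `q` is integrable on `[0, L]`. -/
def transferMatrix (q : ℝ → ℝ) (L lam : ℝ) : Matrix (Fin 2) (Fin 2) ℝ :=
  Classical.epsilon (IsTransferMatrix q L lam)

/-! ### Periodic quantum graphs with two periods -/

/-- A `ℤ²`-periodic quantum graph with real Robin vertex conditions, described by a fundamental
domain with vertices `V` and edges `E`. The edge `e`, parametrized by `[0, length e]`, runs from the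
vertex `tail e` at `0` to the vertex `shift e • head e` at `length e`. -/
structure PeriodicQuantumGraph (V E : Type) where
  tail : E → V
  head : E → V
  shift : E → Fin 2 → ℤ
  length : E → ℝ
  length_pos : ∀ e, 0 < length e
  potential : E → ℝ → ℝ
  integrable_potential : ∀ e, IntegrableOn (potential e) (Icc 0 (length e))
  robin : V → ℝ

namespace PeriodicQuantumGraph

variable {V E : Type} (Γ : PeriodicQuantumGraph V E)

/-- Transfer matrix of the edge `e` at energy `lam`. -/
def edgeTransfer (e : E) (lam : ℝ) : Matrix (Fin 2) (Fin 2) ℝ :=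
  transferMatrix (Γ.potential e) (Γ.length e) lam

/-- The value, at the far end of the edge, of the solution with data `(1, 0)`. -/
def c (e : E) (lam : ℝ) : ℝ := Γ.edgeTransfer e lam 0 0
/-- The Dirichlet spectral function of `e`. -/
def s (e : E) (lam : ℝ) : ℝ := Γ.edgeTransfer e lam 0 1
/-- The derivative along the edge, at its far end, of the solution with data `(0, 1)`. -/
def s' (e : E) (lam : ℝ) : ℝ := Γ.edgeTransfer e lam 1 1

/-- The set of all Dirichlet eigenvalues of the edges, where the spectral matrix has its poles. -/
def dirichletSpectrum : Set ℝ := {lam | ∃ e, Γ.s e lam = 0}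

variable [DecidableEq V] [Fintype E]

/-- The spectral matrix `Â(z, lam)`: the sum of the Dirichlet-to-Neumann matrices
`s⁻¹ (-c, z^g; z^{-g}, -s')` of the edges, minus the diagonal matrix of Robin parameters. -/
def spectralMatrix (z : Fin 2 → ℂ) (lam : ℝ) : Matrix V V ℂ :=
  (∑ e : E,
    (Matrix.single (Γ.tail e) (Γ.tail e) (-(Γ.c e lam : ℂ) / Γ.s e lam) +
     Matrix.single (Γ.tail e) (Γ.head e) ((∏ i, z i ^ Γ.shift e i) / (Γ.s e lam : ℂ)) +
     Matrix.single (Γ.head e) (Γ.tail e) ((∏ i, z i ^ (-Γ.shift e i)) / (Γ.s e lam : ℂ)) +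
     Matrix.single (Γ.head e) (Γ.head e) (-(Γ.s' e lam : ℂ) / Γ.s e lam))) -
  Matrix.diagonal (fun v => (Γ.robin v : ℂ))

variable [Fintype V]

/-- The dispersion function `D(z, lam) = det Â(z, lam)`. -/
def dispersionFunction (z : Fin 2 → ℂ) (lam : ℝ) : ℂ := (Γ.spectralMatrix z lam).det

/-- The dispersion relation `D(e^{ik₁}, e^{ik₂}, lam) = 0` between real quasimomenta `k` and
energies `lam` that are not poles of the spectral matrix. -/
def dispersionRelation : Set ((Fin 2 → ℝ) × ℝ) :=
  {p | p.2 ∉ Γ.dirichletSpectrum ∧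
    Γ.dispersionFunction (fun i => Complex.exp (Complex.I * p.1 i)) p.2 = 0}

end PeriodicQuantumGraph

/-! ### AA-stacked graphene -/

/-- The data of `n + 1` sheets of graphene in AA-stacking, joined by `n` red and `n` green connector
edges per period. A colour is an element of `Fin 2`: `0` is red (the vertex `v₁`), `1` is green
(the vertex `v₂`). All potentials and all Robin parameters are arbitrary; the edges of the layers
have length `1`. -/
structure AAStack (n : ℕ) where
  /-- potential on edge `i` of layer `j`, oriented from `v₁` to `v₂` -/
  layerPotential : Fin (n + 1) → Fin 3 → ℝ → ℝ
  integrable_layer : ∀ j i, IntegrableOn (layerPotential j i) (Icc 0 1)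
  /-- Robin parameter of the vertex of given colour in layer `j` -/
  robin : Fin 2 → Fin (n + 1) → ℝ
  /-- length of the connector edge of given colour from layer `j` to layer `j + 1` -/
  connectorLength : Fin 2 → Fin n → ℝ
  connectorLength_pos : ∀ a j, 0 < connectorLength a j
  /-- potential on that connector edge, oriented from layer `j` to layer `j + 1` -/
  connectorPotential : Fin 2 → Fin n → ℝ → ℝ
  integrable_connector : ∀ a j,
    IntegrableOn (connectorPotential a j) (Icc 0 (connectorLength a j))

namespace AAStack

variable {n : ℕ} (A : AAStack n)

/-- The quantum graph of the stack. Vertices are pairs (colour, layer); edges are either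
(layer, edge of the layer) or (colour, gap between two layers). In each layer the three edges of a
period join the red vertex to the green vertices shifted by `0`, `ξ₁` and `ξ₂`. -/
def graph : PeriodicQuantumGraph (Fin 2 × Fin (n + 1)) ((Fin (n + 1) × Fin 3) ⊕ (Fin 2 × Fin n)) where
  tail := Sum.elim (fun e => (0, e.1)) (fun e => (e.1, e.2.castSucc))
  head := Sum.elim (fun e => (1, e.1)) (fun e => (e.1, e.2.succ))
  shift := Sum.elim (fun e => ![![0, 0], ![1, 0], ![0, 1]] e.2) (fun _ => 0)
  length := Sum.elim (fun _ => 1) (fun e => A.connectorLength e.1 e.2)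
  length_pos := by
    rintro (e | e)
    · exact one_pos
    · exact A.connectorLength_pos e.1 e.2
  potential := Sum.elim (fun e => A.layerPotential e.1 e.2) (fun e => A.connectorPotential e.1 e.2)
  integrable_potential := by
    rintro (e | e)
    · exact A.integrable_layer e.1 e.2
    · exact A.integrable_connector e.1 e.2
  robin := fun v => A.robin v.1 v.2

/-- The finite (hence unshifted) connector graph of colour `a`: a chain of `n` edges. -/
def connectorGraph (a : Fin 2) : PeriodicQuantumGraph (Fin (n + 1)) (Fin n) where
  tail := Fin.castSucc
  head := Fin.succ
  shift := fun _ => 0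
  length := A.connectorLength a
  length_pos := A.connectorLength_pos a
  potential := A.connectorPotential a
  integrable_potential := A.integrable_connector a
  robin := fun _ => 0

/-- The diagonal matrix `𝐛_a(lam)` of the layers: the entry of layer `j` is
`-∑ᵢ cᵢ/sᵢ - α` for red and `-∑ᵢ sᵢ'/sᵢ - α` for green vertices. -/
def layerMatrix (a : Fin 2) (lam : ℝ) : Matrix (Fin (n + 1)) (Fin (n + 1)) ℂ :=
  Matrix.diagonal fun j =>
    -(∑ i : Fin 3, ((if a = 0 then A.graph.c (.inl (j, i)) lam else A.graph.s' (.inl (j, i)) lam : ℝ)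
        : ℂ) / A.graph.s (.inl (j, i)) lam) - A.robin a j

/-- The matrix `B̃_a(lam) = 𝐛_a(lam) + B_a(lam)`, where `B_a` is the spectral matrix of the
connector graph of colour `a` (it does not depend on `z`). -/
def BTilde (a : Fin 2) (lam : ℝ) : Matrix (Fin (n + 1)) (Fin (n + 1)) ℂ :=
  A.layerMatrix a lam + (A.connectorGraph a).spectralMatrix 1 lam

/-- The characteristic matrix `Δ(lam) = s₀(lam)² B̃₁(lam) B̃₂(lam)`, where `s₀` is the Dirichlet
spectral function of the edges of the layers (taken on one of them; it is used only when all of them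
carry the same potential). -/
def charMatrix (lam : ℝ) : Matrix (Fin (n + 1)) (Fin (n + 1)) ℂ :=
  (A.graph.s (.inl (0, 0)) lam : ℂ) ^ 2 • (A.BTilde 0 lam * A.BTilde 1 lam)

end AAStack

/-! ### Conical singularities -/

/-- `G̃(k₁, k₂) = |1 + e^{ik₁} + e^{ik₂}|²`. -/
def GTilde (k : Fin 2 → ℝ) : ℝ :=
  ‖(1 + Complex.exp (Complex.I * k 0) + Complex.exp (Complex.I * k 1) : ℂ)‖ ^ 2

/-- `κ₁² - κ₁κ₂ + κ₂²`. If `κᵢ = K · ξᵢ` for a wavevector `K` in the plane, where `ξ₁, ξ₂` are the two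
elementary shifts of the hexagonal lattice, which have equal length and enclose an angle of `60°`,
then this is a constant multiple of the squared Euclidean length of `K`. -/
def hexForm (κ : Fin 2 → ℝ) : ℝ := κ 0 ^ 2 - κ 0 * κ 1 + κ 1 ^ 2

/-- The set `T` of pairs (quasimomentum, energy) is, near `(k₀, lam₀)`, a two-sided cone with apex
`(k₀, lam₀)`: it consists of two continuous sheets `lam = lo k` and `lam = hi k` that lie strictly
below and strictly above `lam₀` except at `k₀`, and on both of them `(lam - lam₀)² ≈ C |k - k₀|²` to
leading order for some `C > 0`, `|·|` being the hexagonal norm. -/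
def IsConicalAt (T : Set ((Fin 2 → ℝ) × ℝ)) (k₀ : Fin 2 → ℝ) (lam₀ : ℝ) : Prop :=
  ∃ C : ℝ, 0 < C ∧ ∃ lo hi : (Fin 2 → ℝ) → ℝ,
    lo k₀ = lam₀ ∧ hi k₀ = lam₀ ∧
    (∀ᶠ k in 𝓝 k₀, ContinuousAt lo k ∧ ContinuousAt hi k) ∧
    (∀ᶠ k in 𝓝[≠] k₀, lo k < lam₀ ∧ lam₀ < hi k) ∧
    (∀ᶠ p in 𝓝 (k₀, lam₀), p ∈ T ↔ p.2 = lo p.1 ∨ p.2 = hi p.1) ∧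
    Tendsto (fun k => (lo k - lam₀) ^ 2 / hexForm (k - k₀)) (𝓝[≠] k₀) (𝓝 C) ∧
    Tendsto (fun k => (hi k - lam₀) ^ 2 / hexForm (k - k₀)) (𝓝[≠] k₀) (𝓝 C)

end

end Graphene

/-!
For an energy outside the Dirichlet spectrum, sort the vertices of the stack by colour. Under the
hypotheses the red and the green diagonal blocks of the spectral matrix are one and the same real
symmetric matrix `B` (`AAStack.BTilde_eq`): symmetric potentials have `c = s'`, because reflecting an
edge maps solutions to solutions (`transferMatrix_symm`). The off-diagonal blocks are the scalars
`f / s₀` and `f̄ / s₀` with `f = 1 + e^{ik₁} + e^{ik₂}`, so the spectral matrix is singular as soon as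
`|f|² = G̃(k)` is an eigenvalue of `Δ = s₀² B²` (`AAStack.mem_dispersionRelation`). This puts the points
with `μ(lam) = G̃(k)` into the dispersion relation: near `lam₀` only `lam₀` itself can be a Dirichlet
eigenvalue (`eventually_transferMatrix_ne_zero`), and if it is not one, the apex is reached by
continuity of `Δ` in the energy.

Since `B` is Hermitian, `Δ` is positive semidefinite, hence `μ ≥ 0`, and the zero of `μ` at `lam₀` with
`μ''(lam₀) ≠ 0` is a nondegenerate minimum, `μ(lam) ~ a (lam - lam₀)²` with `a > 0`
(`exists_quadratic_minimum`). On the other side `f` vanishes at `k₀`, and its differential there has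
squared modulus `κ₁² - κ₁κ₂ + κ₂²` (`tendsto_GTilde_div_hexForm`). Inverting `μ` on either side of
`lam₀` gives the two sheets of the cone, with constant `C = 1 / a` (`isConicalAt_of_quadratic`).

The facts about transfer matrices rest on the theory of `-u'' + q u = lam u` with integrable `q`, which
is developed here: existence, uniqueness and continuous dependence on `lam` come from a norm weighted
by `e^{-Mx}`, in which the twice integrated equation is a contraction, and the Lagrange identity from
the fundamental theorem of calculus for absolutely continuous functions.
-/

namespace Graphene

/-! ### A weighted a priori bound for the edge equation -/

/-- Integration gains a factor `1 / M` in the norm weighted by `e^{-Mx}`. -/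
lemma abs_le_of_abs_deriv_le_exp {L γ g K M : ℝ} {w z : ℝ → ℝ} (hM : 0 < M) (hK : 0 ≤ K)
    (hw : ∀ x ∈ Icc 0 L, HasDerivWithinAt w (z x) (Icc 0 L) x)
    (hz : ∀ x ∈ Icc 0 L, |z x| ≤ γ + K * Real.exp (M * x)) (h0 : |w 0| ≤ g) :
    ∀ x ∈ Icc 0 L, |w x| ≤ g + γ * x + K / M * Real.exp (M * x) := by
  have key := image_norm_le_of_norm_deriv_right_le_deriv_boundary (a := 0) (b := L) (f := w)
    (f' := z) (B := fun x => g + γ * x + K / M * Real.exp (M * x))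
    (B' := fun x => γ + K * Real.exp (M * x))
    (fun x hx => (hw x hx).continuousWithinAt)
    (fun x hx => (hw x (Ico_subset_Icc_self hx)).mono_of_mem_nhdsWithin
      (mem_of_superset (Icc_mem_nhdsGE hx.2) (Icc_subset_Icc_left hx.1)))
    (by
      have : 0 ≤ K / M * Real.exp (M * 0) := by positivity
      simp only [Real.norm_eq_abs]; linarith)
    (fun x => by
      have h1 : HasDerivAt (fun x => Real.exp (M * x)) (Real.exp (M * x) * (M * 1)) x :=
        ((hasDerivAt_id x).const_mul M).exp
      have h2 := (((hasDerivAt_id x).const_mul γ).const_add g).add (h1.const_mul (K / M))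
      refine h2.congr_deriv ?_
      field_simp)
    (fun x hx => hz x (Ico_subset_Icc_self hx))
  exact fun x hx => key hx

/-- Integration against an integrable coefficient `p` is bounded by `‖p‖₁` in the norm weighted by
`e^{-Mx}`. -/
lemma integral_abs_mul_abs_le {L P U M x : ℝ} {p f : ℝ → ℝ} (hx : x ∈ Icc 0 L)
    (hp : IntegrableOn p (Icc 0 L)) (hP : ∫ t in (0 : ℝ)..L, |p t| ≤ P) (hM : 0 ≤ M) (hU : 0 ≤ U)
    (hfc : ContinuousOn f (Icc 0 L))
    (hf : ∀ t ∈ Icc 0 L, |f t| ≤ U * Real.exp (M * t)) :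
    ∫ t in (0 : ℝ)..x, |p t| * |f t| ≤ P * U * Real.exp (M * x) := by
  have hL : 0 ≤ L := hx.1.trans hx.2
  have hpL : IntervalIntegrable p volume 0 L :=
    (intervalIntegrable_iff_integrableOn_Icc_of_le hL).2 hp
  have hpx : IntervalIntegrable p volume 0 x :=
    (intervalIntegrable_iff_integrableOn_Icc_of_le hx.1).2 (hp.mono_set (Icc_subset_Icc_right hx.2))
  have hfx : ContinuousOn (fun t => |f t|) (uIcc 0 x) := by
    rw [uIcc_of_le hx.1]
    exact (hfc.mono (Icc_subset_Icc_right hx.2)).abs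
  have hE : 0 ≤ U * Real.exp (M * x) := by positivity
  calc ∫ t in (0 : ℝ)..x, |p t| * |f t|
      ≤ ∫ t in (0 : ℝ)..x, |p t| * (U * Real.exp (M * x)) := by
        refine intervalIntegral.integral_mono_on hx.1 (hpx.abs.mul_continuousOn hfx)
          (hpx.abs.mul_const _) fun t ht => ?_
        refine mul_le_mul_of_nonneg_left ((hf t ⟨ht.1, ht.2.trans hx.2⟩).trans ?_) (abs_nonneg _)
        gcongr
        exact ht.2
    _ = (∫ t in (0 : ℝ)..x, |p t|) * (U * Real.exp (M * x)) :=
        intervalIntegral.integral_mul_const _ _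
    _ ≤ P * (U * Real.exp (M * x)) := by
        refine mul_le_mul_of_nonneg_right (le_trans ?_ hP) hE
        exact intervalIntegral.integral_mono_interval le_rfl hx.1 hx.2
          (Eventually.of_forall fun t => abs_nonneg _) hpL.abs
    _ = P * U * Real.exp (M * x) := by ring

/-- Grönwall-type bound for second-order equations with an integrable coefficient: in the norm
weighted by `e^{-Mx}` with `M = 2P + 1`, the double integration is a contraction. -/
lemma abs_le_of_abs_deriv_le_integral {L P γ g : ℝ} {p w z : ℝ → ℝ} (hL : 0 ≤ L)
    (hp : IntegrableOn p (Icc 0 L)) (hP : ∫ t in (0 : ℝ)..L, |p t| ≤ P) (hγ : 0 ≤ γ)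
    (hw : ∀ x ∈ Icc 0 L, HasDerivWithinAt w (z x) (Icc 0 L) x)
    (hz : ∀ x ∈ Icc 0 L, |z x| ≤ γ + ∫ t in (0 : ℝ)..x, |p t| * |w t|) (h0 : |w 0| ≤ g) :
    ∀ x ∈ Icc 0 L, |w x| ≤ 2 * (g + γ * L) * Real.exp ((2 * P + 1) * x) := by
  have hP0 : 0 ≤ P := le_trans
    (intervalIntegral.integral_nonneg hL fun t _ => abs_nonneg _) hP
  set M := 2 * P + 1 with hMdef
  have hM : 0 < M := by positivity
  have hwc : ContinuousOn w (Icc 0 L) := fun x hx => (hw x hx).continuousWithinAt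
  obtain ⟨x₀, hx₀, hmax⟩ := isCompact_Icc.exists_isMaxOn (nonempty_Icc.2 hL)
    (f := fun x => Real.exp (-(M * x)) * |w x|) (by fun_prop)
  set U := Real.exp (-(M * x₀)) * |w x₀| with hU
  have hU0 : 0 ≤ U := by positivity
  have hwU : ∀ t ∈ Icc 0 L, |w t| ≤ U * Real.exp (M * t) := by
    intro t ht
    have h1 : Real.exp (-(M * t)) * |w t| ≤ U := hmax ht
    calc |w t| = Real.exp (-(M * t)) * |w t| * Real.exp (M * t) := by
          rw [mul_right_comm, ← Real.exp_add]; simp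
      _ ≤ U * Real.exp (M * t) := by gcongr
  have h1 := abs_le_of_abs_deriv_le_exp (K := P * U) hM (by positivity) hw
    (fun x hx => (hz x hx).trans
      (add_le_add_right (integral_abs_mul_abs_le hx hp hP hM.le hU0 hwc hwU) γ)) h0 x₀ hx₀
  have hg : 0 ≤ g := (abs_nonneg _).trans h0
  have hE1 : Real.exp (-(M * x₀)) ≤ 1 := Real.exp_le_one_iff.2 (by
    have := mul_nonneg hM.le hx₀.1
    linarith)
  have hPM : P / M ≤ 1 / 2 := by
    rw [div_le_div_iff₀ hM two_pos]; linarith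
  have h2 : U ≤ (g + γ * L) + U / 2 := by
    calc U ≤ Real.exp (-(M * x₀)) * (g + γ * x₀ + P * U / M * Real.exp (M * x₀)) := by
          rw [hU]; gcongr
      _ = Real.exp (-(M * x₀)) * (g + γ * x₀) + P / M * U := by
          have : Real.exp (-(M * x₀)) * Real.exp (M * x₀) = 1 := by rw [← Real.exp_add]; simp
          linear_combination (P * U / M) * this
      _ ≤ 1 * (g + γ * L) + 1 / 2 * U := by
          have : 0 ≤ g + γ * x₀ := add_nonneg hg (mul_nonneg hγ hx₀.1)
          gcongr
          exact hx₀.2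
      _ = _ := by ring
  intro x hx
  refine (hwU x hx).trans ?_
  gcongr
  linarith

/-! ### Existence, uniqueness and continuous dependence -/

namespace IsEdgeSolution

variable {q : ℝ → ℝ} {L lam : ℝ} {u v : ℝ → ℝ}

lemma continuousOn (h : IsEdgeSolution q L lam u v) : ContinuousOn u (Icc 0 L) :=
  fun x hx => (h.hasDeriv x hx).continuousWithinAt

lemma integrableOn_mul (hq : IntegrableOn q (Icc 0 L)) (h : IsEdgeSolution q L lam u v) :
    IntegrableOn (fun t => (q t - lam) * u t) (Icc 0 L) :=
  (hq.sub (integrableOn_const (by simp))).mul_continuousOn h.continuousOn isCompact_Icc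

lemma intervalIntegrable_mul (hq : IntegrableOn q (Icc 0 L)) (h : IsEdgeSolution q L lam u v)
    {x y : ℝ} (hx : x ∈ Icc 0 L) (hy : y ∈ Icc 0 L) :
    IntervalIntegrable (fun t => (q t - lam) * u t) volume x y := by
  have h1 := (intervalIntegrable_iff_integrableOn_Icc_of_le (hx.1.trans hx.2)).2
    (h.integrableOn_mul hq)
  refine h1.mono_set ?_
  rw [uIcc_of_le (hx.1.trans hx.2)]
  exact uIcc_subset_Icc hx hy

lemma continuousOn_deriv (hL : 0 ≤ L) (hq : IntegrableOn q (Icc 0 L))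
    (h : IsEdgeSolution q L lam u v) : ContinuousOn v (Icc 0 L) := by
  have := intervalIntegral.continuousOn_primitive_interval (a := 0) (b := L)
    (f := fun t => (q t - lam) * u t) (μ := volume)
    (by rw [uIcc_of_le hL]; exact h.integrableOn_mul hq)
  rw [uIcc_of_le hL] at this
  exact (continuousOn_const.add this).congr h.deriv_eq

/-- Two solutions, possibly at different energies, differ by at most a constant times the
differences of their initial data and of the energies. -/
lemma abs_sub_le {lam' P C : ℝ} {u' v' : ℝ → ℝ} (hL : 0 ≤ L) (hq : IntegrableOn q (Icc 0 L))
    (h : IsEdgeSolution q L lam u v) (h' : IsEdgeSolution q L lam' u' v')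
    (hP : ∫ t in (0 : ℝ)..L, |q t - lam| ≤ P) (hC : ∀ x ∈ Icc 0 L, |u' x| ≤ C) :
    ∀ x ∈ Icc 0 L,
      |u x - u' x| ≤ 2 * (|u 0 - u' 0| + (|v 0 - v' 0| + |lam - lam'| * C * L) * L) *
        Real.exp ((2 * P + 1) * x) ∧
      |v x - v' x| ≤ |v 0 - v' 0| + |lam - lam'| * C * L +
        P * (2 * (|u 0 - u' 0| + (|v 0 - v' 0| + |lam - lam'| * C * L) * L)) *
          Real.exp ((2 * P + 1) * x) := by
  set γ := |v 0 - v' 0| + |lam - lam'| * C * L with hγdef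
  have hC0 : 0 ≤ C := (abs_nonneg _).trans (hC 0 ⟨le_rfl, hL⟩)
  have hγ : 0 ≤ γ := by positivity
  have hP0 : 0 ≤ P := le_trans
    (intervalIntegral.integral_nonneg hL fun t _ => abs_nonneg _) hP
  have hp : IntegrableOn (fun t => q t - lam) (Icc 0 L) := hq.sub (integrableOn_const (by simp))
  have hwc : ContinuousOn (fun t => u t - u' t) (Icc 0 L) := h.continuousOn.sub h'.continuousOn
  have hz : ∀ x ∈ Icc 0 L,
      |v x - v' x| ≤ γ + ∫ t in (0 : ℝ)..x, |q t - lam| * |u t - u' t| := by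
    intro x hx
    have h0m : (0 : ℝ) ∈ Icc 0 L := ⟨le_rfl, hL⟩
    have hi : IntervalIntegrable (fun t => (q t - lam) * (u t - u' t)) volume 0 x :=
      (intervalIntegrable_iff_integrableOn_Icc_of_le hx.1).2
        ((hp.mul_continuousOn hwc isCompact_Icc).mono_set (Icc_subset_Icc_right hx.2))
    have hi' : IntervalIntegrable u' volume 0 x :=
      (h'.continuousOn.mono (by
        rw [uIcc_of_le hx.1]; exact Icc_subset_Icc_right hx.2)).intervalIntegrable
    have e : v x - v' x = (v 0 - v' 0) +
        ((∫ t in (0 : ℝ)..x, (q t - lam) * (u t - u' t)) -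
          ∫ t in (0 : ℝ)..x, (lam - lam') * u' t) := by
      rw [h.deriv_eq x hx, h'.deriv_eq x hx, ← intervalIntegral.integral_sub hi
        (hi'.const_mul _)]
      have : (fun t => (q t - lam) * (u t - u' t) - (lam - lam') * u' t) =
          fun t => (q t - lam) * u t - (q t - lam') * u' t := by
        ext t; ring
      rw [this, intervalIntegral.integral_sub (h.intervalIntegrable_mul hq h0m hx)
        (h'.intervalIntegrable_mul hq h0m hx)]
      ring
    have b1 : |∫ t in (0 : ℝ)..x, (q t - lam) * (u t - u' t)| ≤
        ∫ t in (0 : ℝ)..x, |q t - lam| * |u t - u' t| := by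
      refine (intervalIntegral.abs_integral_le_integral_abs hx.1).trans (le_of_eq ?_)
      simp only [abs_mul]
    have b2 : |∫ t in (0 : ℝ)..x, (lam - lam') * u' t| ≤ |lam - lam'| * C * L := by
      have := intervalIntegral.norm_integral_le_of_norm_le_const (a := 0) (b := x)
        (f := fun t => (lam - lam') * u' t) (C := |lam - lam'| * C) (by
          intro t ht
          rw [uIoc_of_le hx.1] at ht
          rw [Real.norm_eq_abs, abs_mul]
          gcongr
          exact hC t ⟨ht.1.le, ht.2.trans hx.2⟩)
      rw [Real.norm_eq_abs, sub_zero, abs_of_nonneg hx.1] at this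
      refine this.trans ?_
      gcongr
      exact hx.2
    rw [e, hγdef]
    have t1 := abs_add_le (v 0 - v' 0) ((∫ t in (0 : ℝ)..x, (q t - lam) * (u t - u' t)) -
          ∫ t in (0 : ℝ)..x, (lam - lam') * u' t)
    have t2 := abs_sub (∫ t in (0 : ℝ)..x, (q t - lam) * (u t - u' t))
          (∫ t in (0 : ℝ)..x, (lam - lam') * u' t)
    linarith
  have hu := abs_le_of_abs_deriv_le_integral (w := fun t => u t - u' t)
    (z := fun t => v t - v' t) (p := fun t => q t - lam) (g := |u 0 - u' 0|) hL hp hP hγ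
    (fun x hx => (h.hasDeriv x hx).sub (h'.hasDeriv x hx)) hz le_rfl
  intro x hx
  refine ⟨hu x hx, (hz x hx).trans ?_⟩
  refine add_le_add_right ?_ γ
  exact integral_abs_mul_abs_le (f := fun t => u t - u' t) hx hp hP (by positivity)
    (by positivity) hwc hu

end IsEdgeSolution

/-- The initial value problem for an integrable potential is solvable: with the substitution
`u = e^{Mx} w`, the twice integrated equation is a fixed point problem for a contraction of
`C([0, L])` when `M` is large. -/
lemma exists_isEdgeSolution {q : ℝ → ℝ} {L : ℝ} (hL : 0 ≤ L) (hq : IntegrableOn q (Icc 0 L))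
    (lam a b : ℝ) : ∃ u v, IsEdgeSolution q L lam u v ∧ u 0 = a ∧ v 0 = b := by
  set p : ℝ → ℝ := (Icc 0 L).indicator fun t => q t - lam with hpdef
  have hp : Integrable p :=
    (integrable_indicator_iff measurableSet_Icc).2 (hq.sub (integrableOn_const (by simp)))
  set P := ∫ t in (0 : ℝ)..L, |p t| with hPdef
  have hP0 : 0 ≤ P := intervalIntegral.integral_nonneg hL fun t _ => abs_nonneg _
  set M := 2 * P + 1 with hMdef
  have hM : 0 < M := by positivity
  let ext (w : C(Icc 0 L, ℝ)) (t : ℝ) : ℝ := Real.exp (M * t) * w (projIcc 0 L hL t)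
  have hext (w) : Continuous (ext w) := by
    have : Continuous fun t => w (projIcc 0 L hL t) := w.continuous.comp continuous_projIcc
    exact (by fun_prop : Continuous fun t => Real.exp (M * t)).mul this
  have hint (w) (x y : ℝ) : IntervalIntegrable (fun t => p t * ext w t) volume x y :=
    hp.intervalIntegrable.mul_continuousOn (hext w).continuousOn
  let V (w : C(Icc 0 L, ℝ)) (x : ℝ) : ℝ := b + ∫ t in (0 : ℝ)..x, p t * ext w t
  have hV (w) : Continuous (V w) :=
    continuous_const.add (intervalIntegral.continuous_primitive (hint w) 0)
  let U (w : C(Icc 0 L, ℝ)) (x : ℝ) : ℝ := a + ∫ s in (0 : ℝ)..x, V w s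
  have hU (w) (x) : HasDerivAt (U w) (V w x) x :=
    (intervalIntegral.integral_hasDerivAt_right ((hV w).intervalIntegrable _ _)
      ((hV w).stronglyMeasurableAtFilter _ _) (hV w).continuousAt).const_add a
  have hUc (w) : Continuous (U w) := continuous_iff_continuousAt.2 fun x => (hU w x).continuousAt
  let T (w : C(Icc 0 L, ℝ)) : C(Icc 0 L, ℝ) :=
    ⟨fun x => Real.exp (-(M * x)) * U w x, by have := hUc w; fun_prop⟩
  have hT : ContractingWith (1 / 2) T := by
    refine ⟨by norm_num, LipschitzWith.of_dist_le_mul fun w₁ w₂ => ?_⟩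
    set D := dist w₁ w₂ with hD
    have hD0 : 0 ≤ D := dist_nonneg
    refine (ContinuousMap.dist_le (by positivity)).2 fun x => ?_
    have hx : (x : ℝ) ∈ Icc 0 L := x.2
    have hdiff : ∀ t, |ext w₁ t - ext w₂ t| ≤ D * Real.exp (M * t) := by
      intro t
      rw [← mul_sub, abs_mul, abs_of_pos (Real.exp_pos _), mul_comm]
      gcongr
      rw [← Real.dist_eq]
      exact ContinuousMap.dist_apply_le_dist _
    have hVd : ∀ x ∈ Icc 0 L, |V w₁ x - V w₂ x| ≤ 0 + P * D * Real.exp (M * x) := by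
      intro x hx
      have : V w₁ x - V w₂ x = ∫ t in (0 : ℝ)..x, p t * (ext w₁ t - ext w₂ t) := by
        simp only [V, add_sub_add_left_eq_sub]
        rw [← intervalIntegral.integral_sub (hint _ _ _) (hint _ _ _)]
        simp only [mul_sub]
      rw [this, zero_add]
      refine (intervalIntegral.abs_integral_le_integral_abs hx.1).trans ?_
      simp only [abs_mul]
      exact integral_abs_mul_abs_le (f := fun t => ext w₁ t - ext w₂ t) hx hp.integrableOn le_rfl
        hM.le hD0 ((hext _).sub (hext _)).continuousOn fun t _ => hdiff t
    have hUd := abs_le_of_abs_deriv_le_exp (g := 0) (w := fun x => U w₁ x - U w₂ x) hM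
      (by positivity)
      (fun x _ => ((hU w₁ x).sub (hU w₂ x)).hasDerivWithinAt) hVd (by simp [U]) x hx
    have hPM : P / M ≤ 1 / 2 := by
      rw [div_le_div_iff₀ hM two_pos]; linarith
    calc dist (T w₁ x) (T w₂ x) = Real.exp (-(M * x)) * |U w₁ x - U w₂ x| := by
          rw [Real.dist_eq]
          simp only [T, ContinuousMap.coe_mk]
          rw [← mul_sub, abs_mul, abs_of_pos (Real.exp_pos _)]
      _ ≤ Real.exp (-(M * x)) * (0 + 0 * x + P * D / M * Real.exp (M * x)) := by gcongr
      _ = P / M * D := by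
          have : Real.exp (-(M * x)) * Real.exp (M * x) = 1 := by rw [← Real.exp_add]; simp
          linear_combination (P * D / M) * this
      _ ≤ 1 / 2 * D := by gcongr
      _ = _ := by simp
  obtain ⟨w, hw⟩ : ∃ w, T w = w := ⟨_, hT.fixedPoint_isFixedPt⟩
  have hfix : ∀ t ∈ Icc 0 L, ext w t = U w t := by
    intro t ht
    have h1 : T w ⟨t, ht⟩ = w ⟨t, ht⟩ := by rw [hw]
    simp only [ext, projIcc_of_mem hL ht, ← h1, T, ContinuousMap.coe_mk]
    rw [← mul_assoc, ← Real.exp_add]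
    simp
  refine ⟨U w, V w, ⟨fun x _ => (hU w x).hasDerivWithinAt, fun x hx => ?_⟩, by simp [U],
    by simp [V]⟩
  have h0 : V w 0 = b := by simp [V]
  rw [h0]
  refine congrArg (b + ·) (intervalIntegral.integral_congr fun t ht => ?_)
  rw [uIcc_of_le hx.1] at ht
  have ht' : t ∈ Icc 0 L := ⟨ht.1, ht.2.trans hx.2⟩
  simp only [hfix t ht', hpdef, indicator_of_mem ht']

/-! ### Linearity, reflection and the Lagrange identity -/

namespace IsEdgeSolution

variable {q : ℝ → ℝ} {L lam : ℝ} {u v : ℝ → ℝ}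

lemma linear_comb {u₁ v₁ u₂ v₂ : ℝ → ℝ} (hq : IntegrableOn q (Icc 0 L))
    (h₁ : IsEdgeSolution q L lam u₁ v₁) (h₂ : IsEdgeSolution q L lam u₂ v₂) (a b : ℝ) :
    IsEdgeSolution q L lam (fun x => a * u₁ x + b * u₂ x) (fun x => a * v₁ x + b * v₂ x) := by
  refine ⟨fun x hx => ((h₁.hasDeriv x hx).const_mul a).add ((h₂.hasDeriv x hx).const_mul b),
    fun x hx => ?_⟩
  have h0 : (0 : ℝ) ∈ Icc 0 L := ⟨le_rfl, hx.1.trans hx.2⟩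
  have i₁ := h₁.intervalIntegrable_mul hq h0 hx
  have i₂ := h₂.intervalIntegrable_mul hq h0 hx
  have : (fun t => (q t - lam) * (a * u₁ t + b * u₂ t)) =
      fun t => a * ((q t - lam) * u₁ t) + b * ((q t - lam) * u₂ t) := by
    ext t; ring
  rw [this, intervalIntegral.integral_add (i₁.const_mul a) (i₂.const_mul b),
    intervalIntegral.integral_const_mul, intervalIntegral.integral_const_mul, h₁.deriv_eq x hx,
    h₂.deriv_eq x hx]
  ring

/-- Locally in the energy, solutions with fixed initial data are Lipschitz in the energy. -/
lemma exists_lipschitz {lam₀ : ℝ} {u₀ v₀ : ℝ → ℝ} (hL : 0 ≤ L) (hq : IntegrableOn q (Icc 0 L))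
    (h₀ : IsEdgeSolution q L lam₀ u₀ v₀) :
    ∃ K, ∀ lam u v, |lam - lam₀| ≤ 1 → IsEdgeSolution q L lam u v → u 0 = u₀ 0 → v 0 = v₀ 0 →
      ∀ x ∈ Icc 0 L, |u x - u₀ x| ≤ K * |lam - lam₀| ∧ |v x - v₀ x| ≤ K * |lam - lam₀| := by
  obtain ⟨C, hC⟩ := isCompact_Icc.exists_bound_of_continuousOn h₀.continuousOn
  have hC0 : 0 ≤ C := (norm_nonneg _).trans (hC 0 ⟨le_rfl, hL⟩)
  have hqL : IntervalIntegrable q volume 0 L :=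
    (intervalIntegrable_iff_integrableOn_Icc_of_le hL).2 hq
  set P := (∫ t in (0 : ℝ)..L, |q t - lam₀|) + L with hPdef
  have hP0 : 0 ≤ P := add_nonneg (intervalIntegral.integral_nonneg hL fun t _ => abs_nonneg _) hL
  set E := Real.exp ((2 * P + 1) * L) with hE
  have hE0 : 0 < E := Real.exp_pos _
  refine ⟨C * L + (2 * (C * L * L) + P * (2 * (C * L * L))) * E, ?_⟩
  intro lam u v hlam h hu hv x hx
  have hP : ∫ t in (0 : ℝ)..L, |q t - lam| ≤ P := by
    calc ∫ t in (0 : ℝ)..L, |q t - lam| ≤ ∫ t in (0 : ℝ)..L, (|q t - lam₀| + 1) := by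
          refine intervalIntegral.integral_mono_on hL (hqL.sub intervalIntegrable_const).abs
            ((hqL.sub intervalIntegrable_const).abs.add intervalIntegrable_const) fun t _ => ?_
          have := _root_.abs_sub_le (q t) lam₀ lam
          rw [abs_sub_comm lam₀ lam] at this
          linarith
      _ = P := by
          rw [intervalIntegral.integral_add (hqL.sub intervalIntegrable_const).abs
            intervalIntegrable_const]
          simp [hPdef]
  obtain ⟨h1, h2⟩ := h.abs_sub_le hL hq h₀ hP hC x hx
  rw [hu, hv] at h1 h2
  simp only [sub_self, abs_zero, zero_add] at h1 h2
  have hEx : Real.exp ((2 * P + 1) * x) ≤ E := by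
    rw [hE]; gcongr; exact hx.2
  have d0 := abs_nonneg (lam - lam₀)
  set δ := |lam - lam₀|
  constructor
  · calc |u x - u₀ x| ≤ 2 * (δ * C * L * L) * Real.exp ((2 * P + 1) * x) := h1
      _ ≤ 2 * (δ * C * L * L) * E := by gcongr
      _ ≤ 2 * (δ * C * L * L) * E + (C * L + (P * (2 * (C * L * L))) * E) * δ :=
          le_add_of_nonneg_right (by positivity)
      _ = _ := by ring
  · calc |v x - v₀ x|
        ≤ δ * C * L + P * (2 * (δ * C * L * L)) * Real.exp ((2 * P + 1) * x) := h2
      _ ≤ δ * C * L + P * (2 * (δ * C * L * L)) * E := by gcongr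
      _ ≤ δ * C * L + P * (2 * (δ * C * L * L)) * E + 2 * (C * L * L) * E * δ :=
          le_add_of_nonneg_right (by positivity)
      _ = _ := by ring

lemma eqOn_of_initial {u' v' : ℝ → ℝ} (hL : 0 ≤ L) (hq : IntegrableOn q (Icc 0 L))
    (h : IsEdgeSolution q L lam u v) (h' : IsEdgeSolution q L lam u' v') (hu : u 0 = u' 0)
    (hv : v 0 = v' 0) : ∀ x ∈ Icc 0 L, u x = u' x ∧ v x = v' x := by
  obtain ⟨K, hK⟩ := h'.exists_lipschitz hL hq
  intro x hx
  have := hK lam u v (by simp) h hu hv x hx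
  simpa [sub_eq_zero] using this

/-- The reflected solution `u(L - x)` solves the equation with the reflected potential. -/
lemma reflect (hL : 0 ≤ L) (hq : IntegrableOn q (Icc 0 L))
    (hsymm : ∀ᵐ x ∂(volume.restrict (Icc 0 L)), q (L - x) = q x)
    (h : IsEdgeSolution q L lam u v) :
    IsEdgeSolution q L lam (fun x => u (L - x)) (fun x => -v (L - x)) := by
  have hmem : ∀ x ∈ Icc 0 L, L - x ∈ Icc 0 L := fun x hx => ⟨by linarith [hx.2], by linarith [hx.1]⟩
  refine ⟨fun x hx => ?_, fun x hx => ?_⟩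
  · have h1 : HasDerivWithinAt (fun x => L - x) (-1) (Icc 0 L) x :=
      (hasDerivWithinAt_id x _).const_sub L
    exact ((h.hasDeriv (L - x) (hmem x hx)).comp x h1 hmem).congr_deriv (by ring)
  · have e1 := h.deriv_eq L ⟨hL, le_rfl⟩
    have e2 := h.deriv_eq (L - x) (hmem x hx)
    have h0 : (0 : ℝ) ∈ Icc 0 L := ⟨le_rfl, hL⟩
    have e3 := intervalIntegral.integral_interval_sub_left
      (h.intervalIntegrable_mul hq h0 ⟨hL, le_rfl⟩) (h.intervalIntegrable_mul hq h0 (hmem x hx))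
    have e4 : ∫ t in (0 : ℝ)..x, (q t - lam) * u (L - t) =
        ∫ t in (0 : ℝ)..x, (q (L - t) - lam) * u (L - t) := by
      refine intervalIntegral.integral_congr_ae ?_
      rw [ae_restrict_iff' measurableSet_Icc] at hsymm
      filter_upwards [hsymm] with t ht hxt
      rw [uIoc_of_le hx.1] at hxt
      rw [ht ⟨hxt.1.le, hxt.2.trans hx.2⟩]
    have e5 := intervalIntegral.integral_comp_sub_left (a := 0) (b := x)
      (fun t => (q t - lam) * u t) L
    simp only [sub_zero] at e5 ⊢
    rw [e4, e5, ← e3]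
    linarith

lemma absolutelyContinuousOnInterval (hL : 0 ≤ L) (hq : IntegrableOn q (Icc 0 L))
    (h : IsEdgeSolution q L lam u v) : AbsolutelyContinuousOnInterval u 0 L := by
  obtain ⟨C, hC⟩ := isCompact_Icc.exists_bound_of_continuousOn (h.continuousOn_deriv hL hq)
  have hC0 : 0 ≤ C := (norm_nonneg _).trans (hC 0 ⟨le_rfl, hL⟩)
  refine LipschitzOnWith.absolutelyContinuousOnInterval (K := C.toNNReal) ?_
  rw [uIcc_of_le hL]
  refine (convex_Icc 0 L).lipschitzOnWith_of_nnnorm_hasDerivWithin_le h.hasDeriv fun x hx => ?_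
  rw [← NNReal.coe_le_coe, Real.coe_toNNReal _ hC0]
  exact hC x hx

/-- Lagrange's identity for the Wronskian of solutions at two energies. -/
lemma wronskian {lam' : ℝ} {u' v' : ℝ → ℝ} (hL : 0 ≤ L) (hq : IntegrableOn q (Icc 0 L))
    (h : IsEdgeSolution q L lam u v) (h' : IsEdgeSolution q L lam' u' v') :
    u L * v' L - v L * u' L - (u 0 * v' 0 - v 0 * u' 0) =
      (lam - lam') * ∫ t in (0 : ℝ)..L, u t * u' t := by
  have h0 : (0 : ℝ) ∈ Icc 0 L := ⟨le_rfl, hL⟩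
  have hLm : L ∈ Icc 0 L := ⟨hL, le_rfl⟩
  have i := h.intervalIntegrable_mul hq h0 hLm
  have i' := h'.intervalIntegrable_mul hq h0 hLm
  have iu : IntervalIntegrable (fun t => u t * u' t) volume 0 L :=
    ContinuousOn.intervalIntegrable (by
      rw [uIcc_of_le hL]; exact h.continuousOn.mul h'.continuousOn)
  set z : ℝ → ℝ := fun x => v 0 + ∫ t in (0 : ℝ)..x, (q t - lam) * u t with hz
  set z' : ℝ → ℝ := fun x => v' 0 + ∫ t in (0 : ℝ)..x, (q t - lam') * u' t with hz'
  have cst : ∀ c : ℝ, AbsolutelyContinuousOnInterval (fun _ => c) 0 L := fun c =>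
    ((LipschitzWith.const c).lipschitzOnWith).absolutelyContinuousOnInterval
  have acz : AbsolutelyContinuousOnInterval z 0 L :=
    (cst (v 0)).fun_add (i.absolutelyContinuousOnInterval_intervalIntegral (by simp))
  have acz' : AbsolutelyContinuousOnInterval z' 0 L :=
    (cst (v' 0)).fun_add (i'.absolutelyContinuousOnInterval_intervalIntegral (by simp))
  have acu := h.absolutelyContinuousOnInterval hL hq
  have acu' := h'.absolutelyContinuousOnInterval hL hq
  have acF : AbsolutelyContinuousOnInterval (fun x => u x * z' x - z x * u' x -
      (lam - lam') * ∫ t in (0 : ℝ)..x, u t * u' t) 0 L :=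
    ((acu.fun_mul acz').fun_sub (acz.fun_mul acu')).fun_sub
      ((iu.absolutelyContinuousOnInterval_intervalIntegral (by simp)).const_mul _)
  obtain ⟨C, hC⟩ := acF.const_of_ae_hasDerivAt_zero (by
    have n0 : ∀ᵐ x : ℝ, x ≠ 0 := by simp [ae_iff, measure_singleton]
    have nL : ∀ᵐ x : ℝ, x ≠ L := by simp [ae_iff, measure_singleton]
    filter_upwards [i.ae_hasDerivAt_integral, i'.ae_hasDerivAt_integral,
      iu.ae_hasDerivAt_integral, n0, nL] with x h1 h2 h3 h4 h5 hx
    have d1 := (h1 hx 0 (by simp)).const_add (v 0)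
    have d2 := (h2 hx 0 (by simp)).const_add (v' 0)
    have d3 := h3 hx 0 (by simp)
    rw [uIcc_of_le hL] at hx
    have hnb : Icc 0 L ∈ 𝓝 x := Icc_mem_nhds (lt_of_le_of_ne hx.1 h4.symm) (lt_of_le_of_ne hx.2 h5)
    have e1 := (h.hasDeriv x hx).hasDerivAt hnb
    have e2 := (h'.hasDeriv x hx).hasDerivAt hnb
    refine (((e1.mul d2).sub (d1.mul e2)).sub (d3.const_mul (lam - lam'))).congr_deriv ?_
    have z1 := h.deriv_eq x hx
    have z2 := h'.deriv_eq x hx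
    rw [← z1, ← z2]
    ring)
  have c0 := hC 0 (by simp)
  have cL := hC L (by simp)
  simp only [hz, hz', ← h.deriv_eq L hLm, ← h'.deriv_eq L hLm] at c0 cL
  simp only [intervalIntegral.integral_same, mul_zero, add_zero, sub_zero] at c0
  linarith

end IsEdgeSolution

/-! ### The transfer matrix -/

section Transfer

variable {q : ℝ → ℝ} {L : ℝ}

lemma isTransferMatrix_transferMatrix (hL : 0 ≤ L) (hq : IntegrableOn q (Icc 0 L)) (lam : ℝ) :
    IsTransferMatrix q L lam (transferMatrix q L lam) := by
  refine Classical.epsilon_spec (p := IsTransferMatrix q L lam) ?_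
  obtain ⟨u₁, v₁, h₁, hu₁, hv₁⟩ := exists_isEdgeSolution hL hq lam 1 0
  obtain ⟨u₂, v₂, h₂, hu₂, hv₂⟩ := exists_isEdgeSolution hL hq lam 0 1
  refine ⟨!![u₁ L, u₂ L; v₁ L, v₂ L], fun u v h => ?_⟩
  obtain ⟨e1, e2⟩ := h.eqOn_of_initial hL hq (h₁.linear_comb hq h₂ (u 0) (v 0))
    (by simp [hu₁, hu₂]) (by simp [hv₁, hv₂]) L ⟨hL, le_rfl⟩
  ext i
  fin_cases i
  · simp [e1, Matrix.mulVec, dotProduct]; ring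
  · simp [e2, Matrix.mulVec, dotProduct]; ring

lemma IsEdgeSolution.apply_end {lam : ℝ} {u v : ℝ → ℝ} (hL : 0 ≤ L)
    (hq : IntegrableOn q (Icc 0 L)) (h : IsEdgeSolution q L lam u v) :
    transferMatrix q L lam 0 0 * u 0 + transferMatrix q L lam 0 1 * v 0 = u L ∧
    transferMatrix q L lam 1 0 * u 0 + transferMatrix q L lam 1 1 * v 0 = v L := by
  have := isTransferMatrix_transferMatrix hL hq lam u v h
  have h0 := congrFun this 0
  have h1 := congrFun this 1
  simp [Matrix.mulVec, dotProduct] at h0 h1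
  exact ⟨h0, h1⟩

lemma continuous_transferMatrix (hL : 0 ≤ L) (hq : IntegrableOn q (Icc 0 L)) (i j : Fin 2) :
    Continuous fun lam => transferMatrix q L lam i j := by
  choose u v h hu hv using fun lam =>
    exists_isEdgeSolution hL hq lam (![1, 0] j) (![0, 1] j)
  have e : ∀ lam, transferMatrix q L lam i j = ![u lam L, v lam L] i := by
    intro lam
    obtain ⟨h0, h1⟩ := (h lam).apply_end hL hq
    rw [hu, hv] at h0 h1
    fin_cases i <;> fin_cases j <;> simp_all
  rw [continuous_iff_continuousAt]
  intro lam₀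
  obtain ⟨K, hK⟩ := (h lam₀).exists_lipschitz hL hq
  have hb : ∀ᶠ lam in 𝓝 lam₀,
      dist (transferMatrix q L lam i j) (transferMatrix q L lam₀ i j) ≤ K * |lam - lam₀| := by
    filter_upwards [Metric.closedBall_mem_nhds lam₀ one_pos] with lam hlam
    have := hK lam (u lam) (v lam) hlam (h lam) (by rw [hu, hu]) (by rw [hv, hv]) L ⟨hL, le_rfl⟩
    rw [e, e, Real.dist_eq]
    fin_cases i
    · exact this.1
    · exact this.2
  rw [ContinuousAt, tendsto_iff_dist_tendsto_zero]
  refine squeeze_zero' (Eventually.of_forall fun _ => dist_nonneg) hb ?_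
  have : Continuous fun lam : ℝ => K * |lam - lam₀| := by fun_prop
  simpa using this.tendsto lam₀

/-- The Dirichlet eigenvalues of an edge are isolated: eigenfunctions at different energies are
orthogonal, whereas eigenfunctions at nearby energies are uniformly close. -/
lemma eventually_transferMatrix_ne_zero (hL : 0 < L) (hq : IntegrableOn q (Icc 0 L)) (lam₀ : ℝ) :
    ∀ᶠ lam in 𝓝[≠] lam₀, transferMatrix q L lam 0 1 ≠ 0 := by
  by_cases hs : transferMatrix q L lam₀ 0 1 = 0
  swap
  · exact ((continuous_transferMatrix hL.le hq 0 1).continuousAt.eventually_ne hs).filter_mono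
      nhdsWithin_le_nhds
  obtain ⟨u₀, v₀, h₀, hu₀, hv₀⟩ := exists_isEdgeSolution hL.le hq lam₀ 0 1
  obtain ⟨K, hK⟩ := h₀.exists_lipschitz hL.le hq
  obtain ⟨C, hC⟩ := isCompact_Icc.exists_bound_of_continuousOn h₀.continuousOn
  have hend : u₀ L = 0 := by
    have := (h₀.apply_end hL.le hq).1
    rw [hu₀, hv₀, hs] at this
    linarith
  have hpos : 0 < ∫ t in (0 : ℝ)..L, u₀ t * u₀ t := by
    by_contra hneg
    have hzero : ∀ t ∈ Icc 0 L, u₀ t = 0 := by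
      by_contra hex
      push Not at hex
      obtain ⟨t, ht, hne⟩ := hex
      exact hneg (intervalIntegral.integral_pos hL (h₀.continuousOn.mul h₀.continuousOn)
        (fun x _ => mul_self_nonneg _) ⟨t, ht, mul_self_pos.2 hne⟩)
    have h0 : (0 : ℝ) ∈ Icc 0 L := ⟨le_rfl, hL.le⟩
    have d1 : HasDerivWithinAt u₀ 0 (Icc 0 L) 0 :=
      (hasDerivWithinAt_const 0 _ (0 : ℝ)).congr hzero (hzero 0 h0)
    have := ((uniqueDiffOn_Icc hL) 0 h0).eq_deriv _ (h₀.hasDeriv 0 h0) d1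
    rw [hv₀] at this
    exact one_ne_zero this
  have hsmall : ∀ᶠ lam in 𝓝 lam₀, K * |lam - lam₀| * C * L < ∫ t in (0 : ℝ)..L, u₀ t * u₀ t := by
    have hc : Continuous fun lam : ℝ => K * |lam - lam₀| * C * L := by fun_prop
    have := hc.tendsto lam₀
    simp only [sub_self, abs_zero, mul_zero, zero_mul] at this
    exact this.eventually_lt_const hpos
  filter_upwards [nhdsWithin_le_nhds hsmall, nhdsWithin_le_nhds
    (Metric.closedBall_mem_nhds lam₀ one_pos), self_mem_nhdsWithin] with lam hlt hball hne hzero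
  obtain ⟨u, v, h, hu, hv⟩ := exists_isEdgeSolution hL.le hq lam 0 1
  have huL : u L = 0 := by
    have := (h.apply_end hL.le hq).1
    rw [hu, hv, hzero] at this
    linarith
  have hw := h.wronskian hL.le hq h₀
  rw [huL, hend, hu, hu₀] at hw
  have horth : ∫ t in (0 : ℝ)..L, u t * u₀ t = 0 := by
    have : (lam - lam₀) * ∫ t in (0 : ℝ)..L, u t * u₀ t = 0 := by linarith
    exact (mul_eq_zero.1 this).resolve_left (sub_ne_zero.2 hne)
  have hii : ∀ f : ℝ → ℝ, ContinuousOn f (Icc 0 L) →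
      IntervalIntegrable (fun t => f t * u₀ t) volume 0 L := fun f hf =>
    ContinuousOn.intervalIntegrable (by rw [uIcc_of_le hL.le]; exact hf.mul h₀.continuousOn)
  have hdiff : ∫ t in (0 : ℝ)..L, (u t - u₀ t) * u₀ t = -∫ t in (0 : ℝ)..L, u₀ t * u₀ t := by
    simp only [sub_mul]
    rw [intervalIntegral.integral_sub (hii u h.continuousOn) (hii u₀ h₀.continuousOn), horth,
      zero_sub]
  have hb := intervalIntegral.norm_integral_le_of_norm_le_const (a := 0) (b := L)
    (f := fun t => (u t - u₀ t) * u₀ t) (C := K * |lam - lam₀| * C) (by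
      intro t ht
      rw [uIoc_of_le hL.le] at ht
      have ht' : t ∈ Icc 0 L := ⟨ht.1.le, ht.2⟩
      have h1 := (hK lam u v hball h (by rw [hu, hu₀]) (by rw [hv, hv₀]) t ht').1
      rw [norm_mul]
      exact mul_le_mul h1 (hC t ht') (norm_nonneg _) ((abs_nonneg _).trans h1))
  rw [hdiff, norm_neg, Real.norm_of_nonneg hpos.le, sub_zero, abs_of_pos hL] at hb
  linarith

/-- For a symmetric potential, `T J T = J` with `J = diag(1, -1)`, since the reflection maps
solutions to solutions; the upper right entry of this relation is `s (c - s') = 0`. -/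
lemma transferMatrix_symm (hL : 0 ≤ L) (hq : IntegrableOn q (Icc 0 L))
    (hsymm : ∀ᵐ x ∂(volume.restrict (Icc 0 L)), q (L - x) = q x) (lam : ℝ)
    (hs : transferMatrix q L lam 0 1 ≠ 0) :
    transferMatrix q L lam 0 0 = transferMatrix q L lam 1 1 := by
  obtain ⟨u, v, h, hu, hv⟩ := exists_isEdgeSolution hL hq lam 0 1
  obtain ⟨h1, h2⟩ := h.apply_end hL hq
  have h3 := ((h.reflect hL hq hsymm).apply_end hL hq).1
  simp only [sub_self, sub_zero] at h3
  rw [← h1, ← h2, hu, hv] at h3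
  refine mul_left_cancel₀ hs ?_
  linarith

/-- The transfer matrix depends on the potential only up to null sets. -/
lemma transferMatrix_congr {q' : ℝ → ℝ}
    (h : ∀ᵐ x ∂(volume.restrict (Icc 0 L)), q x = q' x) (lam : ℝ) :
    transferMatrix q L lam = transferMatrix q' L lam := by
  have key : ∀ u v, IsEdgeSolution q L lam u v ↔ IsEdgeSolution q' L lam u v := by
    intro u v
    have e : ∀ x ∈ Icc 0 L, ∫ t in (0 : ℝ)..x, (q t - lam) * u t =
        ∫ t in (0 : ℝ)..x, (q' t - lam) * u t := by
      intro x hx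
      refine intervalIntegral.integral_congr_ae ?_
      rw [ae_restrict_iff' measurableSet_Icc] at h
      filter_upwards [h] with t ht hxt
      rw [uIoc_of_le hx.1] at hxt
      rw [ht ⟨hxt.1.le, hxt.2.trans hx.2⟩]
    exact ⟨fun H => ⟨H.hasDeriv, fun x hx => by rw [← e x hx]; exact H.deriv_eq x hx⟩,
      fun H => ⟨H.hasDeriv, fun x hx => by rw [e x hx]; exact H.deriv_eq x hx⟩⟩
  have : IsTransferMatrix q L lam = IsTransferMatrix q' L lam := by
    ext T
    simp only [IsTransferMatrix, key]
  rw [transferMatrix, transferMatrix, this]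

end Transfer

/-! ### Linear algebra of the spectral matrix -/

section LinearAlgebra

variable {m : Type*} [Fintype m] [DecidableEq m]

/-- If `B² v = α β v`, then `(α v, -B v)` is in the kernel of `(B, α; β, B)`; for `α = 0` the matrix
is block triangular. -/
lemma det_fromBlocks_smul_one_eq_zero {B : Matrix m m ℂ} {α β : ℂ}
    (h : (B * B - (α * β) • (1 : Matrix m m ℂ)).det = 0) :
    (Matrix.fromBlocks B (α • (1 : Matrix m m ℂ)) (β • (1 : Matrix m m ℂ)) B).det = 0 := by
  by_cases hα : α = 0
  · subst hα
    rw [zero_mul, zero_smul, sub_zero, Matrix.det_mul] at h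
    rw [zero_smul, Matrix.det_fromBlocks_zero₁₂, h]
  · obtain ⟨v, hv, hBv⟩ := Matrix.exists_mulVec_eq_zero_iff.2 h
    rw [Matrix.sub_mulVec, Matrix.smul_mulVec, Matrix.one_mulVec, ← Matrix.mulVec_mulVec,
      sub_eq_zero] at hBv
    refine Matrix.exists_mulVec_eq_zero_iff.1 ⟨Sum.elim (α • v) (-(B.mulVec v)), ?_, ?_⟩
    · intro h0
      refine hv (funext fun i => ?_)
      have := congrFun h0 (Sum.inl i)
      simpa [hα] using this
    · rw [Matrix.fromBlocks_mulVec]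
      have e1 : B.mulVec (α • v) + (α • (1 : Matrix m m ℂ)).mulVec (-(B.mulVec v)) = 0 := by
        rw [Matrix.mulVec_smul, Matrix.smul_mulVec, Matrix.one_mulVec, smul_neg, add_neg_cancel]
      have e2 : (β • (1 : Matrix m m ℂ)).mulVec (α • v) + B.mulVec (-(B.mulVec v)) = 0 := by
        rw [Matrix.smul_mulVec, Matrix.one_mulVec, Matrix.mulVec_neg, hBv, smul_smul, mul_comm β,
          add_neg_cancel]
      simp only [Sum.elim_comp_inl, Sum.elim_comp_inr, e1, e2]
      ext (i | i) <;> rfl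

lemma det_sub_smul_one_eq_zero_of_hasEigenvalue {M : Matrix m m ℂ} {x : ℂ}
    (h : Module.End.HasEigenvalue (Matrix.toLin' M) x) :
    (M - x • (1 : Matrix m m ℂ)).det = 0 := by
  obtain ⟨v, hv⟩ := h.exists_hasEigenvector
  refine Matrix.exists_mulVec_eq_zero_iff.1 ⟨v, hv.2, ?_⟩
  have := hv.apply_eq_smul
  rw [Matrix.toLin'_apply] at this
  rw [Matrix.sub_mulVec, this, Matrix.smul_mulVec, Matrix.one_mulVec, sub_self]

open scoped ComplexOrder in
/-- The matrix `s² B²` is positive semidefinite. -/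
lemma nonneg_of_hasEigenvalue_sq_smul_mul_self {B : Matrix m m ℂ} (hB : B.IsHermitian) {s x : ℝ}
    (h : Module.End.HasEigenvalue (Matrix.toLin' ((s : ℂ) ^ 2 • (B * B))) (x : ℂ)) : 0 ≤ x := by
  obtain ⟨v, hv⟩ := h.exists_hasEigenvector
  have e := hv.apply_eq_smul
  rw [Matrix.toLin'_apply] at e
  have hpsd : ((s : ℂ) ^ 2 • (B * B)).PosSemidef := by
    have h1 := Matrix.posSemidef_conjTranspose_mul_self B
    rw [hB.eq] at h1
    refine h1.smul ?_
    rw [← Complex.ofReal_pow]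
    exact Complex.zero_le_real.2 (sq_nonneg s)
  have h1 := hpsd.dotProduct_mulVec_nonneg v
  rw [e, dotProduct_smul, smul_eq_mul] at h1
  have h2 : 0 < star v ⬝ᵥ v := Matrix.dotProduct_star_self_pos_iff.2 hv.2
  have h3 : (0 : ℂ) ≤ x := le_of_mul_le_mul_right (by simpa using h1) h2
  exact Complex.zero_le_real.1 h3

end LinearAlgebra

/-! ### The spectral matrix of a periodic quantum graph -/

namespace PeriodicQuantumGraph

variable {V E : Type} (Γ : PeriodicQuantumGraph V E)

lemma continuous_edgeTransfer (e : E) (i j : Fin 2) :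
    Continuous fun lam => Γ.edgeTransfer e lam i j :=
  continuous_transferMatrix (Γ.length_pos e).le (Γ.integrable_potential e) i j

lemma eventually_notMem_dirichletSpectrum [Finite E] (lam₀ : ℝ) :
    ∀ᶠ lam in 𝓝[≠] lam₀, lam ∉ Γ.dirichletSpectrum := by
  have := eventually_all.2 fun e =>
    eventually_transferMatrix_ne_zero (Γ.length_pos e) (Γ.integrable_potential e) lam₀
  filter_upwards [this] with lam h
  rintro ⟨e, he⟩
  exact h e he

lemma continuousAt_spectralMatrix [DecidableEq V] [Fintype E] (z : Fin 2 → ℂ) {lam₀ : ℝ}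
    (h : lam₀ ∉ Γ.dirichletSpectrum) : ContinuousAt (Γ.spectralMatrix z) lam₀ := by
  have hs : ∀ e, (Γ.s e lam₀ : ℂ) ≠ 0 := fun e he => h ⟨e, by exact_mod_cast he⟩
  have cc : ∀ e, ContinuousAt (fun lam => (Γ.c e lam : ℂ)) lam₀ := fun e =>
    (Complex.continuous_ofReal.comp (Γ.continuous_edgeTransfer e 0 0)).continuousAt
  have cs : ∀ e, ContinuousAt (fun lam => (Γ.s e lam : ℂ)) lam₀ := fun e =>
    (Complex.continuous_ofReal.comp (Γ.continuous_edgeTransfer e 0 1)).continuousAt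
  have cs' : ∀ e, ContinuousAt (fun lam => (Γ.s' e lam : ℂ)) lam₀ := fun e =>
    (Complex.continuous_ofReal.comp (Γ.continuous_edgeTransfer e 1 1)).continuousAt
  have single : ∀ (i j : V) (g : ℝ → ℂ), ContinuousAt g lam₀ →
      ContinuousAt (fun lam => Matrix.single i j (g lam)) lam₀ := by
    intro i j g hg
    refine continuousAt_pi.2 fun a => continuousAt_pi.2 fun b => ?_
    simp only [Matrix.single_apply]
    split_ifs
    · exact hg
    · exact continuousAt_const
  refine ContinuousAt.sub ?_ continuousAt_const
  refine tendsto_finsetSum _ fun e _ => ?_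
  refine ContinuousAt.add (ContinuousAt.add (ContinuousAt.add ?_ ?_) ?_) ?_
  · exact single _ _ _ ((cc e).neg.div (cs e) (hs e))
  · exact single _ _ _ (continuousAt_const.div (cs e) (hs e))
  · exact single _ _ _ (continuousAt_const.div (cs e) (hs e))
  · exact single _ _ _ ((cs' e).neg.div (cs e) (hs e))

lemma isHermitian_spectralMatrix_one [DecidableEq V] [Fintype E] (lam : ℝ) :
    (Γ.spectralMatrix 1 lam).IsHermitian := by
  rw [Matrix.IsHermitian, spectralMatrix, Matrix.conjTranspose_sub, Matrix.conjTranspose_sum]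
  congr 1
  · refine Finset.sum_congr rfl fun e _ => ?_
    simp only [Matrix.conjTranspose_add, Matrix.conjTranspose_single, Pi.one_apply, one_zpow,
      Finset.prod_const_one, star_div₀, star_neg, star_one, Complex.star_def, Complex.conj_ofReal]
    abel
  · rw [Matrix.diagonal_conjTranspose]
    congr 1
    ext v
    simp

end PeriodicQuantumGraph

/-! ### AA-stacked graphene -/

/-- The vertices of the stack, sorted by colour: red vertices to the left, green ones to the
right. -/
def colourEquiv (m : Type*) : m ⊕ m ≃ Fin 2 × m where
  toFun := Sum.elim (fun j => (0, j)) (fun j => (1, j))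
  invFun p := if p.1 = 0 then .inl p.2 else .inr p.2
  left_inv := by rintro (j | j) <;> simp
  right_inv := by rintro ⟨a, j⟩; fin_cases a <;> simp

namespace AAStack

variable {n : ℕ} (A : AAStack n)

/-- If all layer edges have the same Dirichlet function, the coupling between the red and the green
vertices is scalar. -/
lemma spectralMatrix_submatrix_colourEquiv (z : Fin 2 → ℂ) (lam : ℝ)
    (hs : ∀ j i, A.graph.s (.inl (j, i)) lam = A.graph.s (.inl (0, 0)) lam) :
    (A.graph.spectralMatrix z lam).submatrix (colourEquiv _) (colourEquiv _) =
      Matrix.fromBlocks (A.BTilde 0 lam)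
        (((1 + z 0 + z 1) / (A.graph.s (.inl (0, 0)) lam : ℂ)) • 1)
        (((1 + (z 0)⁻¹ + (z 1)⁻¹) / (A.graph.s (.inl (0, 0)) lam : ℂ)) • 1)
        (A.BTilde 1 lam) := by
  have t1 : ∀ e, A.graph.tail (.inl e) = (0, e.1) := fun _ => rfl
  have t2 : ∀ e, A.graph.tail (.inr e) = (e.1, e.2.castSucc) := fun _ => rfl
  have t3 : ∀ e, A.graph.head (.inl e) = (1, e.1) := fun _ => rfl
  have t4 : ∀ e, A.graph.head (.inr e) = (e.1, e.2.succ) := fun _ => rfl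
  have t5 : ∀ j, A.graph.shift (.inl (j, 0)) = 0 := fun _ => by ext i; fin_cases i <;> rfl
  have t6 : ∀ j, A.graph.shift (.inl (j, 1)) = ![1, 0] := fun _ => rfl
  have t7 : ∀ j, A.graph.shift (.inl (j, 2)) = ![0, 1] := fun _ => rfl
  have t8 : ∀ e, A.graph.shift (.inr e) = 0 := fun _ => rfl
  have t9 : A.graph.robin = fun v => A.robin v.1 v.2 := rfl
  have u1 : ∀ a e, (A.connectorGraph a).tail e = e.castSucc := fun _ _ => rfl
  have u2 : ∀ a e, (A.connectorGraph a).head e = e.succ := fun _ _ => rfl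
  have u3 : ∀ a, (A.connectorGraph a).robin = fun _ => 0 := fun _ => rfl
  have u4 : ∀ a e, (A.connectorGraph a).c e lam = A.graph.c (.inr (a, e)) lam := fun _ _ => rfl
  have u5 : ∀ a e, (A.connectorGraph a).s e lam = A.graph.s (.inr (a, e)) lam := fun _ _ => rfl
  have u6 : ∀ a e, (A.connectorGraph a).s' e lam = A.graph.s' (.inr (a, e)) lam :=
    fun _ _ => rfl
  have key : ∀ (i j : Fin (n + 1)) (F : Fin (n + 1) → ℂ),
      ∑ c, (if c = i ∧ c = j then F c else 0) = if i = j then F i else 0 := by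
    intro i j F
    by_cases hij : i = j
    · simp [hij]
    · rw [if_neg hij]
      refine Finset.sum_eq_zero fun c _ => if_neg fun h => hij (h.1.symm.trans h.2)
  ext (i | i) (j | j) <;>
  simp [PeriodicQuantumGraph.spectralMatrix, BTilde, layerMatrix, colourEquiv, t1, t2, t3, t4, t5,
    t6, t7, t8, t9, u1, u2, u3, u4, u5, u6, Matrix.sum_apply, Fintype.sum_sum_type,
    Fintype.sum_prod_type, Matrix.single_apply, Fin.sum_univ_three, hs, Matrix.diagonal_apply]
  all_goals
    simp only [Finset.sum_add_distrib, key, Matrix.one_apply]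
    split_ifs <;> ring

lemma isHermitian_BTilde (a : Fin 2) (lam : ℝ) : (A.BTilde a lam).IsHermitian := by
  refine Matrix.IsHermitian.add ?_ ((A.connectorGraph a).isHermitian_spectralMatrix_one lam)
  rw [Matrix.IsHermitian, layerMatrix, Matrix.diagonal_conjTranspose]
  congr 1
  ext j
  simp

lemma continuousAt_BTilde (a : Fin 2) {lam₀ : ℝ} (h : lam₀ ∉ A.graph.dirichletSpectrum) :
    ContinuousAt (A.BTilde a) lam₀ := by
  have h' : lam₀ ∉ (A.connectorGraph a).dirichletSpectrum := fun ⟨j, hj⟩ => h ⟨.inr (a, j), hj⟩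
  refine ContinuousAt.add ?_ ((A.connectorGraph a).continuousAt_spectralMatrix 1 h')
  refine continuousAt_pi.2 fun i => continuousAt_pi.2 fun j => ?_
  simp only [layerMatrix, Matrix.diagonal_apply]
  split_ifs
  all_goals first
    | exact continuousAt_const
    | skip
  all_goals
    refine ContinuousAt.sub (ContinuousAt.neg (tendsto_finsetSum _ fun e _ => ?_))
      continuousAt_const
    refine ContinuousAt.div ?_ ?_ fun he => h ⟨.inl (i, e), by exact_mod_cast he⟩
    · exact (Complex.continuous_ofReal.comp (A.graph.continuous_edgeTransfer _ _ _)).continuousAt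
    · exact (Complex.continuous_ofReal.comp (A.graph.continuous_edgeTransfer _ _ _)).continuousAt

lemma continuousAt_charMatrix {lam₀ : ℝ} (h : lam₀ ∉ A.graph.dirichletSpectrum) :
    ContinuousAt A.charMatrix lam₀ := by
  have hs : ContinuousAt (fun lam => (A.graph.s (.inl (0, 0)) lam : ℂ)) lam₀ :=
    (Complex.continuous_ofReal.comp (A.graph.continuous_edgeTransfer _ 0 1)).continuousAt
  have hB : ∀ a i j, ContinuousAt (fun lam => A.BTilde a lam i j) lam₀ := fun a i j =>
    continuousAt_pi.1 (continuousAt_pi.1 (A.continuousAt_BTilde a h) i) j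
  refine continuousAt_pi.2 fun i => continuousAt_pi.2 fun j => ?_
  simp only [charMatrix, Matrix.smul_apply, Matrix.mul_apply, smul_eq_mul]
  exact (hs.pow 2).mul (tendsto_finsetSum _ fun k _ => (hB 0 i k).mul (hB 1 k j))

lemma edgeTransfer_layer (h_same : ∀ j i, ∀ᵐ x ∂(volume.restrict (Icc (0 : ℝ) 1)),
      A.layerPotential j i x = A.layerPotential 0 0 x) (j : Fin (n + 1)) (i : Fin 3) (lam : ℝ) :
    A.graph.edgeTransfer (.inl (j, i)) lam = A.graph.edgeTransfer (.inl (0, 0)) lam :=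
  transferMatrix_congr (h_same j i) lam

lemma s_layer (h_same : ∀ j i, ∀ᵐ x ∂(volume.restrict (Icc (0 : ℝ) 1)),
      A.layerPotential j i x = A.layerPotential 0 0 x) (j : Fin (n + 1)) (i : Fin 3) (lam : ℝ) :
    A.graph.s (.inl (j, i)) lam = A.graph.s (.inl (0, 0)) lam := by
  rw [PeriodicQuantumGraph.s, A.edgeTransfer_layer h_same, PeriodicQuantumGraph.s]

/-- The red and the green diagonal blocks coincide. This holds for all energies, also at zeros of
the Dirichlet functions, where the quotients in the definition are `0` by convention. -/
lemma BTilde_eq (h_same : ∀ j i, ∀ᵐ x ∂(volume.restrict (Icc (0 : ℝ) 1)),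
      A.layerPotential j i x = A.layerPotential 0 0 x)
    (h_symm : ∀ᵐ x ∂(volume.restrict (Icc (0 : ℝ) 1)),
      A.layerPotential 0 0 (1 - x) = A.layerPotential 0 0 x)
    (h_robin : ∀ j, A.robin 0 j = A.robin 1 j)
    (h_length : ∀ j, A.connectorLength 0 j = A.connectorLength 1 j)
    (h_conn : ∀ j, ∀ᵐ x ∂(volume.restrict (Icc (0 : ℝ) (A.connectorLength 0 j))),
      A.connectorPotential 0 j x = A.connectorPotential 1 j x) (lam : ℝ) :
    A.BTilde 1 lam = A.BTilde 0 lam := by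
  have hconn : ∀ j, (A.connectorGraph 1).edgeTransfer j lam =
      (A.connectorGraph 0).edgeTransfer j lam := by
    intro j
    have := transferMatrix_congr (h_conn j) lam
    simp only [PeriodicQuantumGraph.edgeTransfer, connectorGraph]
    rw [this, h_length]
  have hspec : (A.connectorGraph 1).spectralMatrix 1 lam =
      (A.connectorGraph 0).spectralMatrix 1 lam := by
    simp only [PeriodicQuantumGraph.spectralMatrix, PeriodicQuantumGraph.c,
      PeriodicQuantumGraph.s, PeriodicQuantumGraph.s', hconn]
    rfl
  have hcs : ∀ j i, (A.graph.s' (.inl (j, i)) lam : ℂ) / A.graph.s (.inl (j, i)) lam =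
      (A.graph.c (.inl (j, i)) lam : ℂ) / A.graph.s (.inl (j, i)) lam := by
    intro j i
    simp only [PeriodicQuantumGraph.c, PeriodicQuantumGraph.s, PeriodicQuantumGraph.s',
      A.edgeTransfer_layer h_same]
    by_cases hs : A.graph.edgeTransfer (.inl (0, 0)) lam 0 1 = 0
    · simp [hs]
    · have : A.graph.edgeTransfer (.inl (0, 0)) lam 0 0 =
          A.graph.edgeTransfer (.inl (0, 0)) lam 1 1 :=
        transferMatrix_symm zero_le_one (A.integrable_layer 0 0) h_symm lam hs
      rw [this]
  simp only [BTilde, hspec, layerMatrix, one_ne_zero, if_false, if_true, hcs, h_robin]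

end AAStack

/-! ### The shape of `G̃` near its zeros -/

lemma hexForm_pos {κ : Fin 2 → ℝ} (h : κ ≠ 0) : 0 < hexForm κ := by
  unfold hexForm
  by_contra hneg
  refine h (funext fun i => ?_)
  have h0 : κ 0 = 0 := by nlinarith [sq_nonneg (κ 0), sq_nonneg (2 * κ 1 - κ 0)]
  have h1 : κ 1 = 0 := by nlinarith [sq_nonneg (κ 1), sq_nonneg (2 * κ 0 - κ 1)]
  fin_cases i
  · exact h0
  · exact h1

lemma norm_sq_le_two_mul_hexForm (κ : Fin 2 → ℝ) : ‖κ‖ ^ 2 ≤ 2 * hexForm κ := by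
  have h0 : 0 ≤ 2 * hexForm κ := by
    unfold hexForm
    nlinarith [sq_nonneg (κ 0 - κ 1), sq_nonneg (κ 0), sq_nonneg (κ 1)]
  have : ‖κ‖ ≤ √(2 * hexForm κ) := by
    refine (pi_norm_le_iff_of_nonneg (Real.sqrt_nonneg _)).2 fun i => ?_
    refine Real.le_sqrt_of_sq_le ?_
    rw [Real.norm_eq_abs, sq_abs]
    unfold hexForm
    fin_cases i
    · change κ 0 ^ 2 ≤ _
      nlinarith [sq_nonneg (κ 0 - κ 1), sq_nonneg (κ 0), sq_nonneg (κ 1)]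
    · change κ 1 ^ 2 ≤ _
      nlinarith [sq_nonneg (κ 0 - κ 1), sq_nonneg (κ 0), sq_nonneg (κ 1)]
  calc ‖κ‖ ^ 2 ≤ √(2 * hexForm κ) ^ 2 := by gcongr
    _ = _ := Real.sq_sqrt h0

lemma continuous_GTilde : Continuous GTilde := by
  unfold GTilde
  fun_prop

lemma GTilde_nonneg (k : Fin 2 → ℝ) : 0 ≤ GTilde k := sq_nonneg _

/-- At the points `±(2π/3, -2π/3)` the two exponentials are the primitive third roots of unity. -/
lemma exp_dirac_point {k₀ : Fin 2 → ℝ}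
    (h : k₀ = ![2 * Real.pi / 3, -(2 * Real.pi / 3)] ∨
      k₀ = ![-(2 * Real.pi / 3), 2 * Real.pi / 3]) :
    ∃ σ : ℝ, σ ^ 2 = 3 / 4 ∧
      Complex.exp (Complex.I * k₀ 0) = -1 / 2 + σ * Complex.I ∧
      Complex.exp (Complex.I * k₀ 1) = -1 / 2 - σ * Complex.I := by
  have hc : Real.cos (2 * Real.pi / 3) = -1 / 2 := by
    rw [show 2 * Real.pi / 3 = Real.pi - Real.pi / 3 by ring, Real.cos_pi_sub,
      Real.cos_pi_div_three]
    norm_num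
  have hs : Real.sin (2 * Real.pi / 3) = √3 / 2 := by
    rw [show 2 * Real.pi / 3 = Real.pi - Real.pi / 3 by ring, Real.sin_pi_sub,
      Real.sin_pi_div_three]
  have hp : Complex.exp (Complex.I * (2 * Real.pi / 3 : ℝ)) =
      -1 / 2 + (√3 / 2 : ℝ) * Complex.I := by
    rw [mul_comm, Complex.exp_mul_I, ← Complex.ofReal_cos, ← Complex.ofReal_sin, hc, hs]
    push_cast
    ring
  have hm : Complex.exp (Complex.I * (-(2 * Real.pi / 3) : ℝ)) =
      -1 / 2 - (√3 / 2 : ℝ) * Complex.I := by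
    rw [mul_comm, Complex.exp_mul_I, ← Complex.ofReal_cos, ← Complex.ofReal_sin, Real.cos_neg,
      Real.sin_neg, hc, hs]
    push_cast
    ring
  have h3 : (√3 / 2) ^ 2 = (3 / 4 : ℝ) := by
    rw [div_pow, Real.sq_sqrt (by norm_num)]; norm_num
  rcases h with rfl | rfl
  · exact ⟨√3 / 2, h3, hp, hm⟩
  · refine ⟨-(√3 / 2), by rw [neg_sq, h3], ?_, ?_⟩
    · refine hm.trans ?_
      push_cast
      ring
    · refine hp.trans ?_
      push_cast
      ring

lemma GTilde_dirac_point {k₀ : Fin 2 → ℝ}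
    (h : k₀ = ![2 * Real.pi / 3, -(2 * Real.pi / 3)] ∨
      k₀ = ![-(2 * Real.pi / 3), 2 * Real.pi / 3]) : GTilde k₀ = 0 := by
  obtain ⟨σ, -, h0, h1⟩ := exp_dirac_point h
  have : (1 + Complex.exp (Complex.I * k₀ 0) + Complex.exp (Complex.I * k₀ 1) : ℂ) = 0 := by
    rw [h0, h1]; ring
  simp [GTilde, this]

/-- The differential of `1 + e^{ik₁} + e^{ik₂}` at `k₀` is `κ ↦ i (ω κ₁ + ω̄ κ₂)` with a primitive
third root of unity `ω`, and its squared modulus is the hexagonal form. -/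
lemma tendsto_GTilde_div_hexForm {k₀ : Fin 2 → ℝ}
    (h : k₀ = ![2 * Real.pi / 3, -(2 * Real.pi / 3)] ∨
      k₀ = ![-(2 * Real.pi / 3), 2 * Real.pi / 3]) :
    Tendsto (fun k => GTilde k / hexForm (k - k₀)) (𝓝[≠] k₀) (𝓝 1) := by
  obtain ⟨σ, hσ, h0, h1⟩ := exp_dirac_point h
  set f : (Fin 2 → ℝ) → ℂ := fun k =>
    1 + Complex.exp (Complex.I * k 0) + Complex.exp (Complex.I * k 1) with hf
  set ℓ : (Fin 2 → ℝ) → ℂ := fun κ =>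
    Complex.I * ((-1 / 2 + σ * Complex.I) * κ 0 + (-1 / 2 - σ * Complex.I) * κ 1) with hℓ
  have hnorm : ∀ κ, ‖ℓ κ‖ ^ 2 = hexForm κ := by
    intro κ
    rw [← Complex.normSq_eq_norm_sq, hexForm, hℓ]
    simp [Complex.normSq_apply]
    linear_combination (κ 0 - κ 1) ^ 2 * hσ
  have hfd : (fun k => f k - ℓ (k - k₀)) =o[𝓝 k₀] fun k => k - k₀ := by
    have hproj : ∀ i : Fin 2, HasFDerivAt (fun k : Fin 2 → ℝ => Complex.exp (Complex.I * k i))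
        (Complex.exp (Complex.I * k₀ i) • (Complex.I •
          (Complex.ofRealCLM.comp (ContinuousLinearMap.proj (R := ℝ) (φ := fun _ => ℝ) i)))) k₀ := by
      intro i
      exact ((Complex.ofRealCLM.comp (ContinuousLinearMap.proj (R := ℝ)
        (φ := fun _ : Fin 2 => ℝ) i)).hasFDerivAt.const_mul Complex.I).cexp
    have hd : HasFDerivAt f _ k₀ := ((hproj 0).const_add 1).add (hproj 1)
    refine hd.isLittleO.congr_left fun k => ?_
    simp only [hf, hℓ, add_apply, smul_apply, ContinuousLinearMap.comp_apply, ContinuousLinearMap.proj_apply, Complex.ofRealCLM_apply,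
      smul_eq_mul, h0, h1, Pi.sub_apply]
    push_cast
    ring
  have hO : (fun k => k - k₀) =O[𝓝 k₀] fun k => ℓ (k - k₀) := by
    refine Asymptotics.IsBigO.of_bound 2 (Eventually.of_forall fun k => ?_)
    refine (sq_le_sq₀ (norm_nonneg _) (by positivity)).1 ?_
    have := norm_sq_le_two_mul_hexForm (k - k₀)
    have h2 := hnorm (k - k₀)
    nlinarith [sq_nonneg ‖ℓ (k - k₀)‖]
  have ho : (fun k => ‖f k‖ - ‖ℓ (k - k₀)‖) =o[𝓝 k₀] fun k => ‖ℓ (k - k₀)‖ := by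
    refine (Asymptotics.IsBigO.of_bound 1 (Eventually.of_forall fun k => ?_)).trans_isLittleO
      (hfd.trans_isBigO hO).norm_right
    rw [Real.norm_eq_abs, one_mul]
    exact abs_norm_sub_norm_le _ _
  have heq : Asymptotics.IsEquivalent (𝓝 k₀) (fun k => ‖f k‖) fun k => ‖ℓ (k - k₀)‖ := ho
  have hsq := (heq.pow 2).mono (nhdsWithin_le_nhds (s := {k₀}ᶜ))
  rw [Asymptotics.isEquivalent_iff_tendsto_one] at hsq
  · refine hsq.congr fun k => ?_
    simp only [Pi.div_apply, Pi.pow_apply, hnorm]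
    rfl
  · filter_upwards [self_mem_nhdsWithin] with k hk
    simp only [Pi.pow_apply, hnorm]
    exact (hexForm_pos (sub_ne_zero.2 hk)).ne'

/-! ### Inverting `μ` on both sides of its zero -/

/-- A strictly monotone continuous function on a compact interval has a left inverse that is
continuous and strictly monotone on the whole line. -/
lemma exists_continuous_leftInverse {f : ℝ → ℝ} {a b : ℝ} (hab : a ≤ b)
    (hc : ContinuousOn f (Icc a b)) (hm : StrictMonoOn f (Icc a b)) :
    ∃ g : ℝ → ℝ, Continuous g ∧ StrictMono g ∧ ∀ x ∈ Icc a b, g (f x) = x := by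
  -- `f` is extended beyond the interval by affine functions of slope `1`
  set p : ℝ → ℝ := fun x => max a (min x b) with hp
  have hpm : ∀ x, p x ∈ Icc a b := fun x => ⟨le_max_left _ _, max_le hab (min_le_right _ _)⟩
  have hpid : ∀ x ∈ Icc a b, p x = x := fun x hx => by
    simp [hp, min_eq_left hx.2, max_eq_right hx.1]
  have hpc : Continuous p := by fun_prop
  set F : ℝ → ℝ := fun x => f (p x) + (x - p x) with hF
  have hFc : Continuous F :=
    (hc.comp_continuous hpc hpm).add (continuous_id.sub hpc)
  have hFm : StrictMono F := by
    intro x y hxy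
    have h1 : p x ≤ p y := by simp only [hp]; gcongr
    have h2 : x - p x ≤ y - p y := by
      simp only [hp]
      rcases le_total x b with h | h <;> rcases le_total y b with h' | h' <;>
        simp only [min_eq_left, min_eq_right, h, h'] <;>
        rcases le_total a x with g | g <;> rcases le_total a y with g' | g' <;>
        rcases le_total a b with g'' | g'' <;>
        simp only [max_eq_left, max_eq_right, g, g', g''] <;> linarith
    rcases h1.lt_or_eq with h | h
    · have := hm (hpm x) (hpm y) h
      simp only [hF]
      linarith
    · simp only [hF, h]
      linarith
  have hFtop : Tendsto F atTop atTop := by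
    refine tendsto_atTop_mono' _ ?_ (tendsto_atTop_add_const_right _ (f b - b) tendsto_id)
    filter_upwards [eventually_ge_atTop b] with x hx
    have : p x = b := by simp [hp, min_eq_right hx, max_eq_right hab]
    simp only [hF, this, id]
    linarith
  have hFbot : Tendsto F atBot atBot := by
    refine tendsto_atBot_mono' _ ?_ (tendsto_atBot_add_const_right _ (f a - a) tendsto_id)
    filter_upwards [eventually_le_atBot a] with x hx
    have : p x = a := by simp [hp, hx]
    simp only [hF, this, id]
    linarith
  set e := hFm.orderIsoOfSurjective F (hFc.surjective hFtop hFbot) with he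
  refine ⟨e.symm, e.symm.continuous, e.symm.strictMono, fun x hx => ?_⟩
  have : f x = e x := by
    rw [he, StrictMono.coe_orderIsoOfSurjective]
    simp [hF, hpid x hx]
  rw [this, e.symm_apply_apply]

/-- The inverse branch `g` of `μ` to the right of its zero `lam₀`. Since `g` is defined and continuous
on the whole line, no domain has to be tracked when it is composed with `G̃`. -/
lemma exists_inverse_branch {μ : ℝ → ℝ} {lam₀ δ : ℝ} (hδ : 0 < δ) (h0 : μ lam₀ = 0)
    (hc : ContinuousOn μ (Icc lam₀ (lam₀ + δ))) (hm : StrictMonoOn μ (Icc lam₀ (lam₀ + δ))) :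
    ∃ (g : ℝ → ℝ) (m : ℝ), 0 < m ∧ Continuous g ∧ g 0 = lam₀ ∧ (∀ t, 0 < t → lam₀ < g t) ∧
      (∀ lam ∈ Icc lam₀ (lam₀ + δ), ∀ t, μ lam = t → lam = g t) ∧
      ∀ t, 0 ≤ t → t < m → μ (g t) = t := by
  have hle : lam₀ ≤ lam₀ + δ := by linarith
  obtain ⟨g, hgc, hgm, hg⟩ := exists_continuous_leftInverse hle hc hm
  have hg0 : g 0 = lam₀ := by rw [← h0]; exact hg _ ⟨le_rfl, hle⟩
  refine ⟨g, μ (lam₀ + δ), ?_, hgc, hg0, fun t ht => hg0 ▸ hgm ht, fun lam hlam t ht => ?_,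
    fun t ht htm => ?_⟩
  · rw [← h0]
    exact hm ⟨le_rfl, hle⟩ ⟨hle, le_rfl⟩ (by linarith)
  · rw [← ht, hg lam hlam]
  · obtain ⟨x, hx, rfl⟩ := intermediate_value_Icc hle hc (by rw [h0]; exact ⟨ht, htm.le⟩)
    rw [hg x hx]

/-- A nonnegative function with a zero at `lam₀` and nonzero second derivative there is a
nondegenerate minimum: to second order it is `a (lam - lam₀)²` with `a > 0`. -/
lemma exists_quadratic_minimum {μ : ℝ → ℝ} {lam₀ : ℝ}
    (h_diff : ∀ᶠ lam in 𝓝 lam₀, DifferentiableAt ℝ μ lam)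
    (h_diff2 : DifferentiableAt ℝ (deriv μ) lam₀) (h_zero : μ lam₀ = 0)
    (h_second : deriv (deriv μ) lam₀ ≠ 0) (h_nonneg : ∀ᶠ lam in 𝓝[≠] lam₀, 0 ≤ μ lam) :
    ∃ a, 0 < a ∧ Tendsto (fun lam => μ lam / (lam - lam₀) ^ 2) (𝓝[≠] lam₀) (𝓝 a) ∧
      ∀ᶠ lam in 𝓝[≠] lam₀, 0 < deriv μ lam / (lam - lam₀) := by
  have hmin : IsLocalMin μ lam₀ := by
    rw [eventually_nhdsWithin_iff] at h_nonneg
    filter_upwards [h_nonneg] with lam h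
    rw [h_zero]
    by_cases he : lam = lam₀
    · rw [he, h_zero]
    · exact h he
  have hd0 := hmin.deriv_eq_zero
  have hslope : Tendsto (fun lam => deriv μ lam / (lam - lam₀)) (𝓝[≠] lam₀)
      (𝓝 (deriv (deriv μ) lam₀)) := by
    refine (hasDerivAt_iff_tendsto_slope.1 h_diff2.hasDerivAt).congr fun lam => ?_
    rw [slope_def_field, hd0, sub_zero]
  have hquad : Tendsto (fun lam => μ lam / (lam - lam₀) ^ 2) (𝓝[≠] lam₀)
      (𝓝 (deriv (deriv μ) lam₀ / 2)) := by
    refine HasDerivAt.lhopital_zero_nhdsNE (f' := deriv μ) (g' := fun lam => 2 * (lam - lam₀))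
      (nhdsWithin_le_nhds (h_diff.mono fun _ h => h.hasDerivAt)) (Eventually.of_forall fun x => ?_)
      ?_ ?_ ?_ ?_
    · exact (((hasDerivAt_id x).sub_const lam₀).pow 2).congr_deriv (by simp)
    · filter_upwards [self_mem_nhdsWithin] with x hx
      exact mul_ne_zero two_ne_zero (sub_ne_zero.2 hx)
    · have := h_diff.self_of_nhds.continuousAt.tendsto
      rw [h_zero] at this
      exact this.mono_left nhdsWithin_le_nhds
    · have : Continuous fun x : ℝ => (x - lam₀) ^ 2 := by fun_prop
      have := this.tendsto lam₀
      simp only [sub_self, ne_eq, OfNat.ofNat_ne_zero, not_false_eq_true, zero_pow] at this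
      exact this.mono_left nhdsWithin_le_nhds
    · refine (hslope.div_const 2).congr fun x => ?_
      rw [div_div, mul_comm 2]
  have hge : 0 ≤ deriv (deriv μ) lam₀ / 2 :=
    ge_of_tendsto hquad (h_nonneg.mono fun lam h => div_nonneg h (sq_nonneg _))
  have hpos : 0 < deriv (deriv μ) lam₀ := lt_of_le_of_ne (by linarith) h_second.symm
  exact ⟨_, half_pos hpos, hquad, hslope.eventually_const_lt hpos⟩

/-- The level set `μ(lam) = G(k)` of a nonnegative function `μ` with a nondegenerate zero and of a
function `G` with the hexagonal form as its leading part is a cone. -/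
lemma isConicalAt_of_quadratic {μ : ℝ → ℝ} {lam₀ : ℝ} {G : (Fin 2 → ℝ) → ℝ} {k₀ : Fin 2 → ℝ}
    (h_diff : ∀ᶠ lam in 𝓝 lam₀, DifferentiableAt ℝ μ lam)
    (h_diff2 : DifferentiableAt ℝ (deriv μ) lam₀) (h_zero : μ lam₀ = 0)
    (h_second : deriv (deriv μ) lam₀ ≠ 0) (h_nonneg : ∀ᶠ lam in 𝓝[≠] lam₀, 0 ≤ μ lam)
    (hG : Continuous G) (hG0 : G k₀ = 0) (hGnn : ∀ k, 0 ≤ G k)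
    (hGhex : Tendsto (fun k => G k / hexForm (k - k₀)) (𝓝[≠] k₀) (𝓝 1)) :
    IsConicalAt {p | μ p.2 = G p.1} k₀ lam₀ := by
  obtain ⟨a, ha, hquad, hder⟩ :=
    exists_quadratic_minimum h_diff h_diff2 h_zero h_second h_nonneg
  obtain ⟨δ, hδ, hball⟩ : ∃ δ > 0, ∀ lam ∈ Icc (lam₀ - δ) (lam₀ + δ), DifferentiableAt ℝ μ lam ∧
      (lam ≠ lam₀ → 0 < deriv μ lam / (lam - lam₀)) := by
    rw [eventually_nhdsWithin_iff] at hder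
    obtain ⟨ε, hε, h⟩ := Metric.nhds_basis_closedBall.mem_iff.1 (h_diff.and hder)
    refine ⟨ε, hε, fun lam hlam => h ?_⟩
    rwa [Real.closedBall_eq_Icc]
  have hcR : ContinuousOn μ (Icc lam₀ (lam₀ + δ)) := fun x hx =>
    (hball x ⟨by linarith [hx.1], hx.2⟩).1.continuousAt.continuousWithinAt
  have hcL : ContinuousOn (fun x => μ (-x)) (Icc (-lam₀) (-lam₀ + δ)) := fun x hx => by
    have h1 := (hball (-x) ⟨by linarith [hx.2], by linarith [hx.1]⟩).1.continuousAt
    exact (ContinuousAt.comp (f := fun x : ℝ => -x) h1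
      continuous_neg.continuousAt).continuousWithinAt
  have hmR : StrictMonoOn μ (Icc lam₀ (lam₀ + δ)) := by
    refine strictMonoOn_of_deriv_pos (convex_Icc _ _) hcR fun x hx => ?_
    rw [interior_Icc] at hx
    have h1 := (hball x ⟨by linarith [hx.1], hx.2.le⟩).2 hx.1.ne'
    exact (div_pos_iff_of_pos_right (by linarith [hx.1])).1 h1
  have hmL : StrictMonoOn (fun x => μ (-x)) (Icc (-lam₀) (-lam₀ + δ)) := by
    refine strictMonoOn_of_deriv_pos (convex_Icc _ _) hcL fun x hx => ?_
    rw [interior_Icc] at hx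
    have h1 := (hball (-x) ⟨by linarith [hx.2], by linarith [hx.1]⟩).2 (by linarith [hx.1])
    rw [deriv_comp_neg]
    have h2 : -x - lam₀ < 0 := by linarith [hx.1]
    rcases div_pos_iff.1 h1 with h | h
    · exact absurd h.2 (by linarith)
    · linarith [h.1]
  obtain ⟨gR, mR, hmR0, hgRc, hgR0, hgRpos, hgR1, hgR2⟩ := exists_inverse_branch hδ h_zero hcR hmR
  obtain ⟨gL, mL, hmL0, hgLc, hgL0, hgLpos, hgL1, hgL2⟩ :=
    exists_inverse_branch (μ := fun x => μ (-x)) hδ (by simpa using h_zero) hcL hmL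
  have hGpos : ∀ᶠ k in 𝓝[≠] k₀, 0 < G k := by
    filter_upwards [hGhex.eventually_const_lt one_pos, self_mem_nhdsWithin] with k hk hne
    exact (div_pos_iff_of_pos_right (hexForm_pos (sub_ne_zero.2 hne))).1 hk
  have hGlt : ∀ m : ℝ, 0 < m → ∀ᶠ k in 𝓝 k₀, G k < m := fun m hm => by
    have := hG.tendsto k₀
    rw [hG0] at this
    exact this.eventually_lt_const hm
  -- on a sheet `lam = b k` with `μ (b k) = G k`, the quotient is `(b k - lam₀)² / μ (b k)` times
  -- `G k / hexForm (k - k₀)`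
  have hlim : ∀ b : (Fin 2 → ℝ) → ℝ, Continuous b → b k₀ = lam₀ →
      (∀ᶠ k in 𝓝[≠] k₀, b k ≠ lam₀) → (∀ᶠ k in 𝓝[≠] k₀, μ (b k) = G k) →
      Tendsto (fun k => (b k - lam₀) ^ 2 / hexForm (k - k₀)) (𝓝[≠] k₀) (𝓝 a⁻¹) := by
    intro b hb hb0 hbne hbG
    have h1 : Tendsto b (𝓝[≠] k₀) (𝓝[≠] lam₀) := by
      refine tendsto_nhdsWithin_iff.2 ⟨?_, hbne⟩
      have := hb.tendsto k₀
      rw [hb0] at this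
      exact this.mono_left nhdsWithin_le_nhds
    have h2 := ((hquad.comp h1).inv₀ ha.ne').mul hGhex
    rw [mul_one] at h2
    refine h2.congr' ?_
    filter_upwards [hbG, hGpos] with k hk hpos
    simp only [Function.comp_apply, hk, inv_div]
    field_simp
  refine ⟨a⁻¹, inv_pos.2 ha, fun k => -gL (G k), fun k => gR (G k), ?_, ?_, ?_, ?_, ?_, ?_, ?_⟩
  · simp [hG0, hgL0]
  · simp [hG0, hgR0]
  · exact Eventually.of_forall fun k =>
      ⟨(hgLc.comp hG).neg.continuousAt, (hgRc.comp hG).continuousAt⟩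
  · filter_upwards [hGpos] with k hk
    exact ⟨by linarith [hgLpos _ hk], hgRpos _ hk⟩
  · rw [nhds_prod_eq]
    have hlam : ∀ᶠ lam in 𝓝 lam₀, lam ∈ Icc (lam₀ - δ) (lam₀ + δ) :=
      Icc_mem_nhds (by linarith) (by linarith)
    filter_upwards [((hGlt mR hmR0).and (hGlt mL hmL0)).prod_mk hlam]
    rintro ⟨k, lam⟩ ⟨⟨hkR, hkL⟩, hl⟩
    change μ lam = G k ↔ lam = -gL (G k) ∨ lam = gR (G k)
    constructor
    · intro hμ
      rcases le_total lam lam₀ with h | h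
      · left
        have := hgL1 (-lam) ⟨by linarith, by linarith [hl.1]⟩ (G k) (by simpa using hμ)
        linarith
      · right
        exact hgR1 lam ⟨h, hl.2⟩ (G k) hμ
    · rintro (rfl | rfl)
      · exact hgL2 _ (hGnn k) hkL
      · exact hgR2 _ (hGnn k) hkR
  · refine hlim (fun k => -gL (G k)) (hgLc.comp hG).neg (by simp [hG0, hgL0]) ?_ ?_
    · filter_upwards [hGpos] with k hk
      exact ne_of_lt (by linarith [hgLpos _ hk])
    · filter_upwards [nhdsWithin_le_nhds (hGlt mL hmL0)] with k hk
      exact hgL2 _ (hGnn k) hk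
  · refine hlim (fun k => gR (G k)) (hgRc.comp hG) (by simp [hG0, hgR0]) ?_ ?_
    · filter_upwards [hGpos] with k hk
      exact (hgRpos _ hk).ne'
    · filter_upwards [nhdsWithin_le_nhds (hGlt mR hmR0)] with k hk
      exact hgR2 _ (hGnn k) hk

/-! ### The dispersion relation -/

namespace AAStack

variable {n : ℕ} (A : AAStack n)

/-- If both colours have the same diagonal block `B`, the spectral matrix is `(B, f/s₀; f̄/s₀, B)`
with `|f|² = G̃(k)`, so it is singular as soon as `G̃(k)` is a root of the characteristic polynomial
of `Δ = s₀² B²`. -/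
lemma mem_dispersionRelation
    (hs : ∀ j i lam, A.graph.s (.inl (j, i)) lam = A.graph.s (.inl (0, 0)) lam)
    (hB : ∀ lam, A.BTilde 1 lam = A.BTilde 0 lam) {k : Fin 2 → ℝ} {lam : ℝ}
    (hlam : lam ∉ A.graph.dirichletSpectrum)
    (hdet : (A.charMatrix lam - (GTilde k : ℂ) • 1).det = 0) :
    (k, lam) ∈ A.graph.dispersionRelation := by
  refine ⟨hlam, ?_⟩
  set s := A.graph.s (.inl (0, 0)) lam with hsdef
  have hs0 : (s : ℂ) ≠ 0 := fun h => hlam ⟨.inl (0, 0), by exact_mod_cast h⟩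
  set z : Fin 2 → ℂ := fun i => Complex.exp (Complex.I * k i) with hz
  have hconj : ∀ i, (z i)⁻¹ = (starRingEnd ℂ) (z i) := by
    intro i
    simp only [hz]
    rw [← Complex.exp_neg, ← Complex.exp_conj]
    simp
  have hG : (1 + z 0 + z 1) * (1 + (z 0)⁻¹ + (z 1)⁻¹) = (GTilde k : ℂ) := by
    have : 1 + (z 0)⁻¹ + (z 1)⁻¹ = (starRingEnd ℂ) (1 + z 0 + z 1) := by
      simp [hconj]
    rw [this, Complex.mul_conj, Complex.normSq_eq_norm_sq]
    rfl
  change (A.graph.spectralMatrix z lam).det = 0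
  rw [← Matrix.det_submatrix_equiv_self (colourEquiv _),
    A.spectralMatrix_submatrix_colourEquiv z lam fun j i => hs j i lam, hB]
  refine det_fromBlocks_smul_one_eq_zero ?_
  have hchar : A.charMatrix lam - (GTilde k : ℂ) • 1 = (s : ℂ) ^ 2 •
      (A.BTilde 0 lam * A.BTilde 0 lam - ((1 + z 0 + z 1) / (s : ℂ) *
        ((1 + (z 0)⁻¹ + (z 1)⁻¹) / (s : ℂ))) • (1 : Matrix (Fin (n + 1)) (Fin (n + 1)) ℂ)) := by
    rw [charMatrix, hB, smul_sub, smul_smul, ← hG]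
    congr 2
    field_simp
  rw [hchar, Matrix.det_smul] at hdet
  exact (mul_eq_zero.1 hdet).resolve_left (pow_ne_zero _ (pow_ne_zero _ hs0))

/-- An eigenvalue branch of `Δ` that is continuous at `lam₀` is an eigenvalue there as well. -/
lemma det_charMatrix_sub_eq_zero {lam₀ : ℝ} {μ : ℝ → ℝ} (hlam : lam₀ ∉ A.graph.dirichletSpectrum)
    (hμ : ContinuousAt μ lam₀)
    (h_eig : ∀ᶠ lam in 𝓝[≠] lam₀,
      Module.End.HasEigenvalue (Matrix.toLin' (A.charMatrix lam)) (μ lam : ℂ)) :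
    (A.charMatrix lam₀ - (μ lam₀ : ℂ) • 1).det = 0 := by
  have hc : ContinuousAt (fun lam => A.charMatrix lam - (μ lam : ℂ) • 1) lam₀ := by
    refine continuousAt_pi.2 fun i => continuousAt_pi.2 fun j => ?_
    have h1 := continuousAt_pi.1 (continuousAt_pi.1 (A.continuousAt_charMatrix hlam) i) j
    have h2 : ContinuousAt (fun lam => (μ lam : ℂ)) lam₀ :=
      Complex.continuous_ofReal.continuousAt.comp hμ
    simp only [Matrix.sub_apply, Matrix.smul_apply, smul_eq_mul]
    exact h1.sub (h2.mul continuousAt_const)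
  have hd : ContinuousAt (fun lam => (A.charMatrix lam - (μ lam : ℂ) • 1).det) lam₀ :=
    (Continuous.matrix_det continuous_id).continuousAt.comp hc
  refine tendsto_nhds_unique (hd.tendsto.mono_left (nhdsWithin_le_nhds (s := {lam₀}ᶜ))) ?_
  refine (tendsto_const_nhds (x := (0 : ℂ))).congr' ?_
  filter_upwards [h_eig] with lam h
  exact (det_sub_smul_one_eq_zero_of_hasEigenvalue h).symm

end AAStack

end Graphene

open Graphene

theorem proposition5p1 (n : ℕ) (A : Graphene.AAStack n)
    -- the potentials on all edges of all layers are identical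
    (h_same : ∀ j i, ∀ᵐ x ∂(volume.restrict (Icc (0 : ℝ) 1)),
      A.layerPotential j i x = A.layerPotential 0 0 x)
    -- and symmetric about the centre of the edge
    (h_symm : ∀ᵐ x ∂(volume.restrict (Icc (0 : ℝ) 1)),
      A.layerPotential 0 0 (1 - x) = A.layerPotential 0 0 x)
    -- in each layer the two Robin parameters are equal
    (h_robin : ∀ j, A.robin 0 j = A.robin 1 j)
    -- red and green connector edges agree
    (h_length : ∀ j, A.connectorLength 0 j = A.connectorLength 1 j)
    (h_conn : ∀ j, ∀ᵐ x ∂(volume.restrict (Icc (0 : ℝ) (A.connectorLength 0 j))),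
      A.connectorPotential 0 j x = A.connectorPotential 1 j x)
    -- a branch `μ` of eigenvalues of the characteristic matrix with a nondegenerate zero at `lam₀`
    (lam₀ : ℝ) (μ : ℝ → ℝ)
    (h_eig : ∀ᶠ lam in 𝓝[≠] lam₀,
      Module.End.HasEigenvalue (Matrix.toLin' (A.charMatrix lam)) (μ lam : ℂ))
    (h_diff : ∀ᶠ lam in 𝓝 lam₀, DifferentiableAt ℝ μ lam)
    (h_diff2 : DifferentiableAt ℝ (deriv μ) lam₀)
    (h_zero : μ lam₀ = 0)
    (h_second : deriv (deriv μ) lam₀ ≠ 0)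
    (k₀ : Fin 2 → ℝ)
    (h_k₀ : k₀ = ![2 * Real.pi / 3, -(2 * Real.pi / 3)] ∨
      k₀ = ![-(2 * Real.pi / 3), 2 * Real.pi / 3]) :
    -- the set `μ(lam) = G̃(k)` is a cone near `(k₀, lam₀)`
    Graphene.IsConicalAt {p | μ p.2 = Graphene.GTilde p.1} k₀ lam₀ ∧
    -- and a branch of the dispersion relation
    (∀ᶠ p in 𝓝[≠] (k₀, lam₀), μ p.2 = Graphene.GTilde p.1 → p ∈ A.graph.dispersionRelation) ∧
    (lam₀ ∉ A.graph.dirichletSpectrum → (k₀, lam₀) ∈ A.graph.dispersionRelation) := by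
  have hs := fun j i lam => A.s_layer h_same j i lam
  have hB := A.BTilde_eq h_same h_symm h_robin h_length h_conn
  have hnonneg : ∀ᶠ lam in 𝓝[≠] lam₀, 0 ≤ μ lam := by
    filter_upwards [h_eig] with lam h
    rw [AAStack.charMatrix, hB] at h
    exact nonneg_of_hasEigenvalue_sq_smul_mul_self (A.isHermitian_BTilde 0 lam) h
  have hG0 := GTilde_dirac_point h_k₀
  have hGhex := tendsto_GTilde_div_hexForm h_k₀
  refine ⟨isConicalAt_of_quadratic h_diff h_diff2 h_zero h_second hnonneg continuous_GTilde hG0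
    GTilde_nonneg hGhex, ?_, fun hlam => ?_⟩
  · have hgood : ∀ᶠ lam in 𝓝 lam₀, lam ≠ lam₀ → lam ∉ A.graph.dirichletSpectrum ∧
        Module.End.HasEigenvalue (Matrix.toLin' (A.charMatrix lam)) (μ lam : ℂ) :=
      eventually_nhdsWithin_iff.1
        ((A.graph.eventually_notMem_dirichletSpectrum lam₀).and h_eig)
    have hGne : ∀ᶠ k in 𝓝 k₀, k ≠ k₀ → GTilde k ≠ 0 := by
      refine eventually_nhdsWithin_iff.1 ?_
      filter_upwards [hGhex.eventually_ne one_ne_zero] with k hk h0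
      simp [h0] at hk
    rw [eventually_nhdsWithin_iff, nhds_prod_eq]
    filter_upwards [hGne.prod_mk hgood]
    rintro ⟨k, lam⟩ ⟨hk, hl⟩ hne hμ
    -- on the line `lam = lam₀` only the apex satisfies `μ lam = G̃ k`
    have hlne : lam ≠ lam₀ := by
      rintro rfl
      have hkne : k ≠ k₀ := fun h => hne (by rw [h]; rfl)
      exact hk hkne (hμ.symm.trans h_zero)
    obtain ⟨hd, he⟩ := hl hlne
    refine A.mem_dispersionRelation hs hB hd ?_
    have := det_sub_smul_one_eq_zero_of_hasEigenvalue he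
    rwa [show μ lam = GTilde k from hμ] at this
  · refine A.mem_dispersionRelation hs hB hlam ?_
    have := A.det_charMatrix_sub_eq_zero hlam h_diff.self_of_nhds.continuousAt h_eig
    rwa [h_zero, ← hG0] at this
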